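/- Let $r:\mathbb Z\to\mathbb C$ be an arbitrary function and $n\in\mathbb Z$. For a partition $\lambda$ put $r_\lambda(n)=\prod_{(i,j)\in\lambda} r(n+j-i)$, the product being over the nodes of the Young diagram ($i$ is the row, $j$ the column). *Symmetric functions.* Let $\Lambda=\mathbb C[\gamma_1,\gamma_2,\dots]$, where $\gamma_m=p_m/m$ are the rescaled power sums. Define $h_k$ by $\exp\sum_{m\ge1}\gamma_m z^m=\sum_{k\ge0}h_k(\gamma)z^k$, with $h_k=0$ for $k<0$, and $s_\lambda=\det\big(h_{\lambda_i-i+j}\big)_{1\le i,j\le \ell(\lambda)}$. The $s_\lambda$ form a basis of $\Lambda$; let $\langle\,,\rangle_{r,n}$ be the bilinear form on $\Lambda$ with $\langle s_\lambda,s_\mu\rangle_{r,n}=r_\lambda(n)\,\delta_{\lambda\mu}$, extended coefficientwise to formal power series in the independent variables ${\bf t}=(t_1,t_2,\dots)$ and ${\bf t}^*=(t_1^*,t_2^*,\dots)$ in the first and the second argument respectively. *Free fermions.* Let $\bf A$ be the Clifford algebra over $\mathbb C$ with generators $\psi_m,\psi_m^*$ ($m\in\mathbb Z$) and relations $[\psi_m,\psi_k]_+=[\psi_m^*,\psi_k^*]_+=0$,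 $[\psi_m,\psi^*_k]_+=\delta_{mk}$. Let $F={\bf A}/{\bf A}W_{an}$ be the Fock space, where $W_{an}$ is spanned by $\psi_m$ ($m<0$) and $\psi_m^*$ ($m\ge0$), let $|0\rangle$ be the class of $1$, and let $a\mapsto\langle0|a|0\rangle$ be the vacuum expectation value, i.e. the linear form on $\bf A$ that is $1$ at $1$ and vanishes on ${\bf A}W_{an}$ and on $W_{cr}{\bf A}$, where $W_{cr}$ is spanned by $\psi_m$ ($m\ge0$) and $\psi_m^*$ ($m<0$). Put $\langle n|=\langle0|\Psi_n^*$ and $|n\rangle=\Psi_n|0\rangle$, where $\Psi_n=\psi_{n-1}\cdots\psi_0$, $\Psi_n^*=\psi_0^*\cdots\psi_{n-1}^*$ for $n>0$, $\Psi_0=\Psi_0^*=1$, and $\Psi_n=\psi_n^*\cdots\psi_{-1}^*$, $\Psi^*_n=\psi_{-1}\cdots\psi_n$ for $n<0$. For $k\ge1$ consider the operators on $F$ $$H_k=\sum_{j\in\mathbb Z}\psi_j\psi^*_{j+k},\qquad A_k=\sum_{j\in\mathbb Z}r(j)r(j-1)\cdots r(j-k+1)\,\psi^*_{j-k}\psi_j,$$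 and $H({\bf t})=\sum_{m\ge1}t_mH_m$, $A({\bf t}^*)=\sum_{m\ge1}t_m^*A_m$. Let $$\tau_r(n,{\bf t},{\bf t}^*)=\langle n|e^{H({\bf t})}e^{-A({\bf t}^*)}|n\rangle ,$$ a formal power series in ${\bf t},{\bf t}^*$ over $\mathbb C$. **Claim.** As formal power series in ${\bf t},{\bf t}^*$, $$\tau_r(n,{\bf t},{\bf t}^*)=\Big\langle \exp\sum_{m\ge1}m t_m\gamma_m,\ \exp\sum_{m\ge1}m t^*_m\gamma_m\Big\rangle_{r,n},$$ and $$\tau_r(n,{\bf t},{\bf t}^*)=\sum_{\lambda}r_\lambda(n)\,s_\lambda({\bf t})\,s_\lambda({\bf t}^*),$$ where the sum is over all partitions $\lambda$, including the empty one, and $s_\lambda({\bf t})$ is $s_\lambda$ with $\gamma_m$ replaced by $t_m$; only finitely many $\lambda$ contribute to the coefficient of a given monomial. -/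

import Mathlib

namespace HypTau

noncomputable section

/-! ## Formal power series -/

/-- The formal linear series `∑ i, a i * X i` (possibly infinitely many variables) with
coefficients in a (not necessarily commutative) algebra `R`. -/
def linearSeries {σ R : Type*} [Semiring R] (a : σ → R) : MvPowerSeries σ R := fun d =>
  open Classical in ∑ i ∈ d.support, if d = Finsupp.single i 1 then a i else 0

/-- The formal exponential `∑ k, x ^ k / k!` of a series `x` without constant term. Only the powers
`k ≤ |d|` contribute to the coefficient of the monomial `X ^ d`
(see `coeff_pow_eq_zero_of_degree_lt`), so every coefficient is a finite sum. -/
def formalExp {σ R : Type*} [Semiring R] [Algebra ℂ R] (x : MvPowerSeries σ R) :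
    MvPowerSeries σ R := fun d =>
  ∑ k ∈ Finset.range (d.degree + 1), ((k.factorial : ℂ)⁻¹) • MvPowerSeries.coeff d (x ^ k)

theorem coeff_pow_eq_zero_of_degree_lt {σ R : Type*} [Semiring R] (x : MvPowerSeries σ R)
    (hx : MvPowerSeries.coeff 0 x = 0) (k : ℕ) (d : σ →₀ ℕ) (h : d.degree < k) :
    MvPowerSeries.coeff d (x ^ k) = 0 := by
  classical
  induction k generalizing d with
  | zero => omega
  | succ k ih =>
    rw [pow_succ, MvPowerSeries.coeff_mul]
    refine Finset.sum_eq_zero fun p hp => ?_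
    have hp : p.1 + p.2 = d := by simpa using hp
    by_cases h2 : p.2 = 0
    · rw [h2, hx, mul_zero]
    · rw [ih p.1 ?_, zero_mul]
      have h3 : p.2.degree ≠ 0 := by rwa [Ne, Finsupp.degree_eq_zero_iff]
      have h4 : d.degree = p.1.degree + p.2.degree := by rw [← hp, map_add]
      omega

theorem coeff_zero_linearSeries {σ R : Type*} [Semiring R] (a : σ → R) :
    MvPowerSeries.coeff 0 (linearSeries a) = 0 := rfl

/-- The coefficientwise extension of a pairing `B` to formal series in two independent sets of
variables: if `f = ∑ d, f_d t ^ d` and `g = ∑ e, g_e t* ^ e`, this is the series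
`∑ d e, B f_d g_e t ^ d t* ^ e`. -/
def pairSeries {σ R S : Type*} [Semiring R] [Semiring S] (B : R → S → ℂ)
    (f : MvPowerSeries σ R) (g : MvPowerSeries σ S) : MvPowerSeries (σ ⊕ σ) ℂ := fun d =>
  B (MvPowerSeries.coeff (Finsupp.sumFinsuppEquivProdFinsupp d).1 f)
    (MvPowerSeries.coeff (Finsupp.sumFinsuppEquivProdFinsupp d).2 g)

/-- The formal series `a` is the sum of the family `f`: for each monomial, only finitely many
members of the family contribute, and the contributions add up to the coefficient of `a`. -/
def FormalHasSum {σ ι : Type*} (f : ι → MvPowerSeries σ ℂ) (a : MvPowerSeries σ ℂ) : Prop :=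
  ∀ d : σ →₀ ℕ, (Function.support fun i => MvPowerSeries.coeff d (f i)).Finite ∧
    MvPowerSeries.coeff d a = ∑ᶠ i, MvPowerSeries.coeff d (f i)

/-! ## Symmetric functions -/

/-- The ring `Λ` of symmetric functions over `ℂ`, written as the polynomial ring in the rescaled
power sums `γ_m = p_m / m`, `m = 1, 2, …`; `γ_m` is `MvPolynomial.X m`. The same polynomials are
also evaluated at the times `t_1, t_2, …`. -/
abbrev SymFun : Type := MvPolynomial ℕ+ ℂ

/-- The power series `∑ m ≥ 1, γ_m z ^ m` in `z`. -/
def xi : PowerSeries SymFun := PowerSeries.mk fun m => if h : 0 < m then MvPolynomial.X (m.toPNat h) else 0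

/-- The complete symmetric function `h_k`: `exp (∑ m ≥ 1, γ_m z ^ m) = ∑ k ≥ 0, h_k z ^ k`. -/
def complete (k : ℕ) : SymFun := PowerSeries.coeff k (formalExp (σ := Unit) xi)

/-- `h_k` for an integer index, with `h_k = 0` for `k < 0`. -/
def completeInt : ℤ → SymFun
  | Int.ofNat k => complete k
  | Int.negSucc _ => 0

/-- The Schur function `s_λ = det (h_{λ_i - i + j})`, `1 ≤ i, j ≤ l(λ)`. -/
def schur (μ : YoungDiagram) : SymFun :=
  Matrix.det (Matrix.of fun i j : Fin (μ.colLen 0) =>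
    completeInt ((μ.rowLen i : ℤ) - (i : ℤ) + (j : ℤ)))

/-- `r_λ(x) = ∏ r(x + j - i)` over the nodes `(i, j)` of the diagram of `λ` (`i` is the row). -/
def contentProd (r : ℤ → ℂ) (μ : YoungDiagram) (x : ℤ) : ℂ :=
  ∏ c ∈ μ.cells, r (x + (c.2 : ℤ) - (c.1 : ℤ))

/-! ### The Schur functions form a basis -/

theorem triangular {ι M : Type*} [AddCommGroup M] [Module ℂ M] (b : Module.Basis ι ℂ M) (v : ι → M)
    (m : ι → ℕ) (h : ∀ i, v i - b i ∈ Submodule.span ℂ (b '' {j | m j < m i})) :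
    LinearIndependent ℂ v ∧ ⊤ ≤ Submodule.span ℂ (Set.range v) := by
  classical
  constructor
  · have hcoord : ∀ i i0, m i ≤ m i0 → b.repr (v i) i0 = if i = i0 then 1 else 0 := by
      intro i i0 hi
      have h1 : b.repr (v i - b i) i0 = 0 := by
        have h2 : Submodule.span ℂ (b '' {j | m j < m i}) ≤ LinearMap.ker (b.coord i0) := by
          rw [Submodule.span_le]
          rintro _ ⟨j, hj, rfl⟩
          have hne : j ≠ i0 := by
            rintro rfl
            exact absurd hi (not_le.mpr hj)
          simp [hne]
        simpa using h2 (h i)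
      rw [map_sub, Finsupp.sub_apply, sub_eq_zero] at h1
      rw [h1, b.repr_self, Finsupp.single_apply]
    rw [linearIndependent_iff]
    intro l hl
    by_contra hne
    obtain ⟨i0, hi0, hmax⟩ := Finset.exists_max_image l.support m
      (Finsupp.support_nonempty_iff.mpr hne)
    have h3 : b.repr (Finsupp.linearCombination ℂ v l) i0 = l i0 := by
      rw [Finsupp.linearCombination_apply, Finsupp.sum, map_sum, Finsupp.finsetSum_apply]
      rw [Finset.sum_eq_single_of_mem i0 hi0]
      · simp [hcoord]
      · intro i hi hii
        simp [hcoord i i0 (hmax i hi), hii]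
    rw [hl] at h3
    simp only [map_zero, Finsupp.coe_zero, Pi.zero_apply] at h3
    exact (Finsupp.mem_support_iff.mp hi0) h3.symm
  · have key : ∀ n i, m i < n → b i ∈ Submodule.span ℂ (Set.range v) := by
      intro n
      induction n with
      | zero => intro i hi; omega
      | succ n ih =>
        intro i hi
        have h1 : Submodule.span ℂ (b '' {j | m j < m i}) ≤ Submodule.span ℂ (Set.range v) := by
          rw [Submodule.span_le]
          rintro _ ⟨j, hj, rfl⟩
          have hj : m j < m i := hj
          exact ih j (by omega)
        have h2 := Submodule.sub_mem _ (Submodule.subset_span (Set.mem_range_self i)) (h1 (h i))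
        simpa using h2
    rw [← b.span_eq, Submodule.span_le]
    rintro _ ⟨i, rfl⟩
    exact key _ i (Nat.lt_succ_self _)

/-- Sum of the squares of the parts of the partition with `ν k` parts equal to `k`. -/
def partSq : (ℕ+ →₀ ℕ) →+ ℕ := Finsupp.weight fun k : ℕ+ => (k : ℕ) ^ 2

/-- Sum of the parts of the partition with `ν k` parts equal to `k`. -/
def partSum : (ℕ+ →₀ ℕ) →+ ℕ := Finsupp.weight fun k : ℕ+ => (k : ℕ)

theorem partSq_single (k : ℕ+) (c : ℕ) : partSq (Finsupp.single k c) = c * (k : ℕ) ^ 2 := by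
  simp [partSq, Finsupp.weight_single]

theorem partSum_single (k : ℕ+) (c : ℕ) : partSum (Finsupp.single k c) = c * (k : ℕ) := by
  simp [partSum, Finsupp.weight_single]

theorem partSq_le (ν : ℕ+ →₀ ℕ) : partSq ν ≤ partSum ν ^ 2 := by
  induction ν using Finsupp.induction_linear with
  | zero => simp
  | add f g hf hg => 
    rw [map_add, map_add, add_sq]
    have := Nat.zero_le (2 * partSum f * partSum g)
    omega
  | single k c =>
    rw [partSq_single, partSum_single, mul_pow]
    exact Nat.mul_le_mul_right _ (Nat.le_self_pow (by norm_num) c)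

/-- Span of the monomials in the `γ_m` with `partSq < n`. -/
def lowSpan (n : ℕ) : Submodule ℂ SymFun :=
  Submodule.span ℂ (MvPolynomial.basisMonomials ℕ+ ℂ '' {ν | partSq ν < n})

theorem lowSpan_mono {a b : ℕ} (h : a ≤ b) : lowSpan a ≤ lowSpan b :=
  Submodule.span_mono (Set.image_mono fun _ hν => lt_of_lt_of_le hν h)

theorem monomial_mem_lowSpan (ν : ℕ+ →₀ ℕ) {n : ℕ} (h : partSq ν < n) :
    MvPolynomial.monomial ν (1 : ℂ) ∈ lowSpan n :=
  Submodule.subset_span ⟨ν, h, by simp⟩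

theorem mul_mem_lowSpan {a b : ℕ} {f g : SymFun} (hf : f ∈ lowSpan a) (hg : g ∈ lowSpan (b + 1)) :
    f * g ∈ lowSpan (a + b) := by
  have h := Submodule.mul_mem_mul hf hg
  rw [lowSpan, lowSpan, Submodule.span_mul_span] at h
  refine Submodule.span_mono ?_ h
  rintro _ ⟨_, ⟨μ, hμ, rfl⟩, _, ⟨ν, hν, rfl⟩, rfl⟩
  refine ⟨μ + ν, ?_, by simp [MvPolynomial.monomial_mul]⟩
  have hμ : partSq μ < a := hμ
  have hν : partSq ν < b + 1 := hν
  change partSq (μ + ν) < a + b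
  rw [map_add]
  omega

theorem coeff_xi_pow_mem (j k : ℕ) : PowerSeries.coeff k (xi ^ j) ∈ lowSpan (k ^ 2 + 1) := by
  induction j generalizing k with
  | zero =>
    rw [pow_zero, PowerSeries.coeff_one]
    split_ifs with h
    · exact monomial_mem_lowSpan 0 (by simp)
    · exact zero_mem _
  | succ j ih =>
    rw [pow_succ xi, PowerSeries.coeff_mul]
    refine Submodule.sum_mem _ fun p hp => ?_
    have hp : p.1 + p.2 = k := by simpa using hp
    rw [xi, PowerSeries.coeff_mk]
    split_ifs with h
    · have h1 : (MvPolynomial.X (p.2.toPNat h) : SymFun) ∈ lowSpan (p.2 ^ 2 + 1) :=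
        monomial_mem_lowSpan _ (by rw [partSq_single, one_mul]; exact Nat.lt_succ_self _)
      refine lowSpan_mono ?_ (mul_mem_lowSpan (ih p.1) h1)
      rw [← hp]; nlinarith
    · rw [mul_zero]; exact zero_mem _

theorem coeff_xi_pow_mem' (j k : ℕ) : PowerSeries.coeff k (xi ^ (j + 2)) ∈ lowSpan (k ^ 2) := by
  rw [pow_succ xi, PowerSeries.coeff_mul]
  refine Submodule.sum_mem _ fun p hp => ?_
  have hp : p.1 + p.2 = k := by simpa using hp
  have h0 : PowerSeries.coeff 0 (xi ^ (j + 1)) = 0 := by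
    rw [PowerSeries.coeff_zero_eq_constantCoeff, map_pow,
      ← PowerSeries.coeff_zero_eq_constantCoeff_apply, xi, PowerSeries.coeff_mk]
    simp
  by_cases hp1 : p.1 = 0
  · rw [hp1, h0, zero_mul]; exact zero_mem _
  rw [xi, PowerSeries.coeff_mk, ← xi]
  split_ifs with h
  · have h1 : (MvPolynomial.X (p.2.toPNat h) : SymFun) ∈ lowSpan (p.2 ^ 2 + 1) :=
      monomial_mem_lowSpan _ (by rw [partSq_single, one_mul]; exact Nat.lt_succ_self _)
    refine lowSpan_mono ?_ (mul_mem_lowSpan (coeff_xi_pow_mem (j + 1) p.1) h1)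
    have : 1 ≤ p.1 := Nat.one_le_iff_ne_zero.mpr hp1
    rw [← hp]; nlinarith
  · rw [mul_zero]; exact zero_mem _

theorem complete_eq (k : ℕ) : complete k =
    ∑ j ∈ Finset.range (k + 1), ((j.factorial : ℂ)⁻¹) • PowerSeries.coeff k (xi ^ j) := by
  have hd : Finsupp.degree (Finsupp.single () k) = k := by simp
  change ∑ j ∈ Finset.range (Finsupp.degree (Finsupp.single () k) + 1), _ = _
  rw [hd]
  rfl

theorem complete_zero : complete 0 = 1 := by
  rw [complete_eq]; simp

theorem complete_sub_mem (k : ℕ+) :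
    complete k - MvPolynomial.monomial (Finsupp.single k 1) 1 ∈ lowSpan ((k : ℕ) ^ 2) := by
  obtain ⟨n, hn⟩ : ∃ n, (k : ℕ) = n + 1 := ⟨k.natPred, by simp⟩
  have h1 : PowerSeries.coeff (k : ℕ) xi = MvPolynomial.monomial (Finsupp.single k 1) 1 := by
    rw [xi, PowerSeries.coeff_mk, dif_pos k.pos]; rfl
  have h0 : PowerSeries.coeff (k : ℕ) (1 : PowerSeries SymFun) = 0 := by
    rw [PowerSeries.coeff_one, if_neg k.pos.ne']
  rw [complete_eq, hn, Finset.sum_range_succ', Finset.sum_range_succ', ← hn]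
  simp only [zero_add, pow_zero, pow_one, h1, h0, Nat.factorial_one, Nat.cast_one, inv_one,
    one_smul, smul_zero, add_zero, add_sub_cancel_right]
  exact Submodule.sum_mem _ fun j _ => Submodule.smul_mem _ _ (coeff_xi_pow_mem' j k)

/-- The product of the complete symmetric functions over the parts of a partition. -/
def completeProd (ν : ℕ+ →₀ ℕ) : SymFun := ν.prod fun k c => complete k ^ c

theorem completeProd_add (μ ν : ℕ+ →₀ ℕ) :
    completeProd (μ + ν) = completeProd μ * completeProd ν :=
  Finsupp.prod_add_index' (by simp) (by intros; rw [pow_add])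

theorem sub_monomial_mul {μ ν : ℕ+ →₀ ℕ} {f g : SymFun}
    (hf : f - MvPolynomial.monomial μ 1 ∈ lowSpan (partSq μ))
    (hg : g - MvPolynomial.monomial ν 1 ∈ lowSpan (partSq ν)) :
    f * g - MvPolynomial.monomial (μ + ν) 1 ∈ lowSpan (partSq (μ + ν)) := by
  have h1 : g ∈ lowSpan (partSq ν + 1) := by
    have := Submodule.add_mem _ (lowSpan_mono (Nat.le_succ _) hg)
      (monomial_mem_lowSpan ν (Nat.lt_succ_self _))
    simpa using this
  have h2 := mul_mem_lowSpan hf h1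
  have h3 := mul_mem_lowSpan hg (monomial_mem_lowSpan μ (Nat.lt_succ_self _))
  rw [map_add]
  rw [add_comm (partSq ν)] at h3
  have h4 : f * g - MvPolynomial.monomial (μ + ν) 1 =
      (f - MvPolynomial.monomial μ 1) * g +
        (g - MvPolynomial.monomial ν 1) * MvPolynomial.monomial μ 1 := by
    have : (MvPolynomial.monomial (μ + ν) 1 : SymFun) =
        MvPolynomial.monomial μ 1 * MvPolynomial.monomial ν 1 := by
      simp [MvPolynomial.monomial_mul]
    rw [this]; ring
  rw [h4]
  exact Submodule.add_mem _ h2 h3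

theorem completeProd_sub_mem (ν : ℕ+ →₀ ℕ) :
    completeProd ν - MvPolynomial.monomial ν 1 ∈ lowSpan (partSq ν) := by
  induction ν using Finsupp.induction_linear with
  | zero => simp [completeProd]
  | add μ ν hμ hν => rw [completeProd_add]; exact sub_monomial_mul hμ hν
  | single k c =>
    induction c with
    | zero => simp [completeProd]
    | succ c ih =>
      have h1 : completeProd (Finsupp.single k 1) = complete k := by simp [completeProd]
      rw [Finsupp.single_add, completeProd_add, h1]
      refine sub_monomial_mul ih ?_
      rw [partSq_single, one_mul]
      exact complete_sub_mem k

/-- The products of complete symmetric functions form a basis. -/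
def completeBasis : Module.Basis (ℕ+ →₀ ℕ) ℂ SymFun :=
  have h := triangular (MvPolynomial.basisMonomials ℕ+ ℂ) completeProd partSq
    (fun ν => by
      rw [MvPolynomial.coe_basisMonomials]
      have := completeProd_sub_mem ν
      rwa [lowSpan, MvPolynomial.coe_basisMonomials] at this)
  Module.Basis.mk h.1 h.2

/-- The exponent of one part `a`, where `a = 0` does not count as a part. -/
def onePart (a : ℕ) : ℕ+ →₀ ℕ := if h : 0 < a then Finsupp.single (a.toPNat h) 1 else 0

theorem onePart_apply (a : ℕ) (k : ℕ+) : onePart a k = if a = (k : ℕ) then 1 else 0 := by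
  rw [onePart]
  split_ifs with h2 h3 h3
  · have : a.toPNat h2 = k := PNat.eq h3
    rw [this]; simp
  · have : a.toPNat h2 ≠ k := fun h => h3 (congrArg PNat.val h)
    exact Finsupp.single_eq_of_ne' this
  · exact absurd k.pos (by omega)
  · rfl

/-- The multiplicities of the positive entries of a list. -/
def mult : List ℕ → (ℕ+ →₀ ℕ)
  | [] => 0
  | a :: L => onePart a + mult L

theorem mult_apply (L : List ℕ) (k : ℕ+) : mult L k = L.count (k : ℕ) := by
  induction L with
  | nil => rfl
  | cons a L ih =>
    rw [mult, Finsupp.add_apply, ih, List.count_cons, add_comm, onePart_apply]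
    simp

theorem completeProd_mult (L : List ℕ) : completeProd (mult L) = (L.map complete).prod := by
  induction L with
  | nil => exact Finsupp.prod_zero_index
  | cons a L ih =>
    rw [mult, completeProd_add, ih, List.map_cons, List.prod_cons]
    congr 1
    rw [onePart]
    split_ifs with h2
    · simp [completeProd]
      rfl
    · obtain rfl : a = 0 := by omega
      simp [completeProd, complete_zero]

theorem partSum_mult (L : List ℕ) : partSum (mult L) = L.sum := by
  induction L with
  | nil => exact map_zero _
  | cons a L ih =>
    rw [mult, map_add, ih, List.sum_cons, onePart]
    split_ifs with h
    · rw [partSum_single, one_mul]; rfl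
    · obtain rfl : a = 0 := by omega
      simp

theorem partSq_mult (L : List ℕ) : partSq (mult L) = (L.map (· ^ 2)).sum := by
  induction L with
  | nil => exact map_zero _
  | cons a L ih =>
    rw [mult, map_add, ih, List.map_cons, List.sum_cons, onePart]
    split_ifs with h
    · rw [partSq_single, one_mul]; rfl
    · obtain rfl : a = 0 := by omega
      simp

theorem mult_rowLens_bijective :
    Function.Bijective fun μ : YoungDiagram => mult μ.rowLens := by
  constructor
  · intro μ ν h
    have hp : μ.rowLens.Perm ν.rowLens := by
      rw [List.perm_iff_count]
      intro a
      rcases Nat.eq_zero_or_pos a with rfl | ha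
      · rw [List.count_eq_zero_of_not_mem, List.count_eq_zero_of_not_mem]
        · exact fun h0 => lt_irrefl _ (ν.pos_of_mem_rowLens 0 h0)
        · exact fun h0 => lt_irrefl _ (μ.pos_of_mem_rowLens 0 h0)
      · have := DFunLike.congr_fun h (⟨a, ha⟩ : ℕ+)
        exact (mult_apply _ _).symm.trans (this.trans (mult_apply _ _))
    apply YoungDiagram.equivListRowLens.injective
    exact Subtype.ext (hp.eq_of_sortedGE μ.rowLens_sorted ν.rowLens_sorted)
  · intro ν
    let L : List ℕ := ((Finsupp.toMultiset ν).map fun k : ℕ+ => (k : ℕ)).sort (· ≥ ·)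
    have hL : L.SortedGE := (Multiset.pairwise_sort _ _).sortedGE
    have hpos : ∀ x ∈ L, 0 < x := by
      intro x hx
      rw [Multiset.mem_sort, Multiset.mem_map] at hx
      obtain ⟨k, -, rfl⟩ := hx
      exact k.pos
    refine ⟨YoungDiagram.ofRowLens L hL, ?_⟩
    ext k
    simp only []
    rw [YoungDiagram.rowLens_ofRowLens_eq_self hpos, mult_apply, ← Multiset.coe_count,
      Multiset.sort_eq, Multiset.count_map_eq_count' _ _ PNat.coe_injective,
      Finsupp.count_toMultiset]

/-- Partitions as Young diagrams versus multiplicities of the parts. -/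
def partitionEquiv : YoungDiagram ≃ (ℕ+ →₀ ℕ) :=
  Equiv.ofBijective (fun μ : YoungDiagram => mult μ.rowLens) mult_rowLens_bijective

theorem rowLens_eq_ofFn (μ : YoungDiagram) :
    μ.rowLens = List.ofFn fun i : Fin (μ.colLen 0) => μ.rowLen i := by
  apply List.ext_get
  · simp
  · intro n h1 h2
    simp [YoungDiagram.rowLens]

theorem perm_eq_one_of_antivary {n : ℕ} (c : Fin n → ℤ) (hc : StrictAnti c)
    (σ : Equiv.Perm (Fin n)) (h : Antivary (c ∘ σ) fun i : Fin n => (i : ℤ)) : σ = 1 := by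
  have hm : StrictMono σ := by
    refine Monotone.strictMono_of_injective (fun i j hij => ?_) σ.injective
    rcases hij.eq_or_lt with rfl | hlt
    · exact le_rfl
    · exact hc.le_iff_ge.mp (h (show (i : ℤ) < j by exact_mod_cast hlt))
  have h2 : (⟨σ, fun {a b} => hm.le_iff_le⟩ : Fin n ≃o Fin n) = OrderIso.refl _ :=
    Subsingleton.elim _ _
  ext i
  exact congrArg Fin.val (DFunLike.congr_fun h2 i)

theorem schur_sub_mem (μ : YoungDiagram) :
    schur μ - (completeBasis.reindex partitionEquiv.symm) μ ∈ Submodule.span ℂ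
      ((completeBasis.reindex partitionEquiv.symm) ''
        {ν | partSum (partitionEquiv ν) ^ 2 - partSq (partitionEquiv ν) <
          partSum (partitionEquiv μ) ^ 2 - partSq (partitionEquiv μ)}) := by
  have hb : ∀ ν, (completeBasis.reindex partitionEquiv.symm) ν =
      completeProd (partitionEquiv ν) := by
    intro ν; simp [completeBasis]
  have hμ : partitionEquiv μ = mult (List.ofFn fun i : Fin (μ.colLen 0) => μ.rowLen i) := by
    rw [← rowLens_eq_ofFn]; rfl
  let c : Fin (μ.colLen 0) → ℤ := fun i => (μ.rowLen i : ℤ) - (i : ℤ)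
  have hc : StrictAnti c := by
    intro i j hij
    have h1 := μ.rowLen_anti i j (by exact_mod_cast hij.le)
    have h2 : (i : ℕ) < j := hij
    simp only [c]
    omega
  have hid : (completeBasis.reindex partitionEquiv.symm) μ =
      ∏ i : Fin (μ.colLen 0), completeInt (c i + (i : ℤ)) := by
    rw [hb, hμ, completeProd_mult, List.map_ofFn, List.prod_ofFn]
    refine Finset.prod_congr rfl fun i _ => ?_
    simp only [c, sub_add_cancel]
    rfl
  have hdet : schur μ - (completeBasis.reindex partitionEquiv.symm) μ =
      ∑ σ ∈ Finset.univ.erase (1 : Equiv.Perm (Fin (μ.colLen 0))),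
        Equiv.Perm.sign σ • ∏ i, completeInt (c (σ i) + (i : ℤ)) := by
    rw [schur, Matrix.det_apply, ← Finset.add_sum_erase _ _ (Finset.mem_univ 1), hid]
    simp [c]
  rw [hdet]
  refine Submodule.sum_mem _ fun σ hσ => ?_
  have hσ1 : σ ≠ 1 := Finset.ne_of_mem_erase hσ
  have hmem : ∏ i, completeInt (c (σ i) + (i : ℤ)) ∈ Submodule.span ℂ
      ((completeBasis.reindex partitionEquiv.symm) ''
        {ν | partSum (partitionEquiv ν) ^ 2 - partSq (partitionEquiv ν) <
          partSum (partitionEquiv μ) ^ 2 - partSq (partitionEquiv μ)}) := by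
    by_cases hneg : ∃ i, c (σ i) + (i : ℤ) < 0
    · obtain ⟨i, hi⟩ := hneg
      rw [Finset.prod_eq_zero (Finset.mem_univ i)]
      · exact zero_mem _
      · rw [Int.eq_negSucc_of_lt_zero hi |>.choose_spec]
        rfl
    · push Not at hneg
      let a : Fin (μ.colLen 0) → ℕ := fun i => (c (σ i) + (i : ℤ)).toNat
      have ha : ∀ i, (a i : ℤ) = c (σ i) + (i : ℤ) := fun i => Int.toNat_of_nonneg (hneg i)
      refine Submodule.subset_span ⟨partitionEquiv.symm (mult (List.ofFn a)), ?_, ?_⟩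
      · change partSum _ ^ 2 - partSq _ < _
        rw [Equiv.apply_symm_apply]
        have h1 : partSum (mult (List.ofFn a)) = partSum (partitionEquiv μ) := by
          rw [hμ, partSum_mult, partSum_mult, List.sum_ofFn, List.sum_ofFn]
          zify
          simp only [ha, Finset.sum_add_distrib]
          rw [Equiv.sum_comp σ c, ← Finset.sum_add_distrib]
          simp [c]
        have h2 : partSq (partitionEquiv μ) < partSq (mult (List.ofFn a)) := by
          rw [hμ, partSq_mult, partSq_mult, List.map_ofFn, List.map_ofFn, List.sum_ofFn,
            List.sum_ofFn]
          simp only [Function.comp]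
          zify
          have e1 : ∀ i : Fin (μ.colLen 0), (μ.rowLen i : ℤ) = c i + (i : ℤ) := by
            intro i; simp [c]
          simp only [ha, e1, add_sq, Finset.sum_add_distrib]
          rw [Equiv.sum_comp σ fun i => c i ^ 2]
          have hanti : Antivary c fun i : Fin (μ.colLen 0) => (i : ℤ) := by
            intro i j hij
            have hij : (i : ℤ) < j := hij
            exact (hc (by exact_mod_cast hij)).le
          have h3 := (hanti.sum_mul_lt_sum_comp_perm_mul_iff (σ := σ)).mpr
            (fun h => hσ1 (perm_eq_one_of_antivary c hc σ h))
          simp only [mul_assoc, ← Finset.mul_sum]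
          linarith
        have h3 := partSq_le (mult (List.ofFn a))
        rw [h1] at h3 ⊢
        omega
      · rw [hb, Equiv.apply_symm_apply, completeProd_mult, List.map_ofFn, List.prod_ofFn]
        refine Finset.prod_congr rfl fun i _ => ?_
        rw [← ha]
        rfl
  rw [Units.smul_def]
  exact zsmul_mem hmem _

/-- The Schur functions form a basis of `Λ`. -/
def schurBasis : Module.Basis YoungDiagram ℂ SymFun :=
  have h := triangular (completeBasis.reindex partitionEquiv.symm) schur
    (fun μ => partSum (partitionEquiv μ) ^ 2 - partSq (partitionEquiv μ)) schur_sub_mem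
  Module.Basis.mk h.1 h.2

theorem schurBasis_apply (μ : YoungDiagram) : schurBasis μ = schur μ := by
  simp [schurBasis]

/-! ### The deformed scalar product -/

/-- The bilinear form `⟨ , ⟩_{r,n}` on `Λ` with `⟨s_λ, s_μ⟩_{r,n} = r_λ(n) δ_{λμ}`. -/
def deformedForm (r : ℤ → ℂ) (n : ℤ) : LinearMap.BilinForm ℂ SymFun :=
  schurBasis.constr ℂ fun μ => contentProd r μ n • schurBasis.coord μ

theorem deformedForm_schur (r : ℤ → ℂ) (n : ℤ) (μ ν : YoungDiagram) :
    deformedForm r n (schur μ) (schur ν) =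
      open Classical in if μ = ν then contentProd r μ n else 0 := by
  rw [← schurBasis_apply, ← schurBasis_apply, deformedForm, Module.Basis.constr_basis]
  rw [LinearMap.smul_apply, Module.Basis.coord_apply, Module.Basis.repr_self, smul_eq_mul]
  split_ifs with h
  · rw [h, Finsupp.single_eq_same, mul_one]
  · rw [Finsupp.single_eq_of_ne h, mul_zero]

/-- The function `exp (∑ m ≥ 1, m t_m γ_m)`, a formal series in the `t_m` with coefficients
in `Λ`. -/
def expGamma : MvPowerSeries ℕ+ SymFun :=
  formalExp (linearSeries fun m : ℕ+ => ((m : ℕ) : ℂ) • (MvPolynomial.X m : SymFun))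

/-- The term `s_λ(t) s_λ(t*)`, as a formal series in the `t_m` (left summand) and the `t*_m`
(right summand). -/
def schurSchur (μ : YoungDiagram) : MvPowerSeries (ℕ+ ⊕ ℕ+) ℂ :=
  pairSeries (fun a b => a * b) (schur μ : MvPowerSeries ℕ+ ℂ) (schur μ : MvPowerSeries ℕ+ ℂ)

/-! ## Free fermions -/

/-- The space `W` of free fermions: `(v, w)` stands for `∑ v m ψ_m + ∑ w m ψ*_m`. -/
abbrev FreeFermion : Type := (ℤ →₀ ℂ) × (ℤ →₀ ℂ)

/-- Vacuum expectation value `⟨0| w w' |0⟩` of a product of two free fermions: it is bilinear,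
`⟨0| ψ_m ψ*_m |0⟩ = 1` for `m < 0`, `⟨0| ψ*_m ψ_m |0⟩ = 1` for `m ≥ 0`, and it vanishes on all other
pairs of generators. -/
def twoPoint : LinearMap.BilinForm ℂ FreeFermion :=
  LinearMap.mk₂ ℂ
    (fun w w' => (w.1.sum fun m c => if m < 0 then c * w'.2 m else 0) +
      (w.2.sum fun m c => if 0 ≤ m then c * w'.1 m else 0))
    (by
      intro a b c
      rw [Prod.fst_add, Prod.snd_add, Finsupp.sum_add_index', Finsupp.sum_add_index']
      · ring
      all_goals intros; split_ifs <;> ring)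
    (by
      intro s a b
      rw [Prod.smul_fst, Prod.smul_snd, Finsupp.sum_smul_index', Finsupp.sum_smul_index']
      · simp only [Finsupp.sum, smul_eq_mul, mul_add, Finset.mul_sum, mul_ite, mul_zero, mul_assoc]
      all_goals simp)
    (by
      intro a b c
      simp only [Finsupp.sum, Prod.fst_add, Prod.snd_add, Finsupp.add_apply]
      rw [add_add_add_comm, ← Finset.sum_add_distrib, ← Finset.sum_add_distrib]
      congr 1 <;> refine Finset.sum_congr rfl fun i _ => ?_ <;> split_ifs <;> ring)
    (by
      intro s a b
      simp only [Finsupp.sum, Prod.smul_fst, Prod.smul_snd, Finsupp.smul_apply, smul_eq_mul,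
        mul_add, Finset.mul_sum]
      congr 1 <;> refine Finset.sum_congr rfl fun i _ => ?_ <;> split_ifs <;> ring)

/-- The quadratic form `(v, w) ↦ ∑ m, v m * w m` on free fermions. In its Clifford algebra,
`[w, w']₊` is the polar form, i.e. `[ψ_m, ψ_n]₊ = [ψ*_m, ψ*_n]₊ = 0` and `[ψ_m, ψ*_n]₊ = δ_mn`. -/
def fermionForm : QuadraticForm ℂ FreeFermion :=
  LinearMap.BilinMap.toQuadraticMap
    (LinearMap.mk₂ ℂ (fun w w' : FreeFermion => w.1.sum fun m c => c * w'.2 m)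
      (by
        intro a b c
        rw [Prod.fst_add, Finsupp.sum_add_index']
        all_goals intros; ring)
      (by
        intro s a b
        rw [Prod.smul_fst, Finsupp.sum_smul_index']
        · simp only [Finsupp.sum, smul_eq_mul, Finset.mul_sum, mul_assoc]
        · simp)
      (by
        intro a b c
        simp only [Finsupp.sum, Prod.snd_add, Finsupp.add_apply, mul_add, Finset.sum_add_distrib])
      (by
        intro s a b
        simp only [Finsupp.sum, Prod.smul_snd, Finsupp.smul_apply, smul_eq_mul, Finset.mul_sum]
        exact Finset.sum_congr rfl fun i _ => by ring))

theorem fermionForm_apply (w : FreeFermion) :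
    fermionForm w = w.1.sum fun m c => c * w.2 m := rfl

theorem twoPoint_apply (w w' : FreeFermion) : twoPoint w w' =
    (w.1.sum fun m c => if m < 0 then c * w'.2 m else 0) +
      (w.2.sum fun m c => if 0 ≤ m then c * w'.1 m else 0) := rfl

theorem twoPoint_self (w : FreeFermion) : twoPoint w w = fermionForm w := by
  rw [fermionForm_apply, twoPoint_apply]
  rw [Finsupp.sum_of_support_subset _ (Finset.subset_union_left (s₂ := w.2.support)) _ (by simp),
    Finsupp.sum_of_support_subset _ (Finset.subset_union_right (s₁ := w.1.support)) _ (by simp),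
    Finsupp.sum_of_support_subset _ (Finset.subset_union_left (s₂ := w.2.support)) _ (by simp),
    ← Finset.sum_add_distrib]
  refine Finset.sum_congr rfl fun i _ => ?_
  by_cases hi : i < 0
  · simp [hi]
  · simp [hi, not_lt.mp hi, mul_comm]

/-- The Clifford algebra of free fermions. -/
abbrev Fermions : Type := CliffordAlgebra fermionForm

/-- The generator `ψ_m`. -/
def psi (m : ℤ) : Fermions := CliffordAlgebra.ι fermionForm (Finsupp.single m 1, 0)

/-- The generator `ψ*_m`. -/
def psiStar (m : ℤ) : Fermions := CliffordAlgebra.ι fermionForm (0, Finsupp.single m 1)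

theorem psi_mul_psi (m n : ℤ) : psi m * psi n + psi n * psi m = 0 := by
  rw [psi, psi, CliffordAlgebra.ι_mul_ι_add_swap, QuadraticMap.polar]
  simp [fermionForm_apply]

theorem psiStar_mul_psiStar (m n : ℤ) : psiStar m * psiStar n + psiStar n * psiStar m = 0 := by
  rw [psiStar, psiStar, CliffordAlgebra.ι_mul_ι_add_swap, QuadraticMap.polar]
  simp [fermionForm_apply]

theorem psi_mul_psiStar (m n : ℤ) :
    psi m * psiStar n + psiStar n * psi m = if m = n then 1 else 0 := by
  rw [psi, psiStar, CliffordAlgebra.ι_mul_ι_add_swap, QuadraticMap.polar]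
  simp [fermionForm_apply, Finsupp.single_apply, eq_comm, apply_ite]

/-- The fermions `ψ_m` (`m < 0`) and `ψ*_m` (`m ≥ 0`), which span `W_an`. -/
def annihilators : Set Fermions :=
  {x | ∃ m : ℤ, (m < 0 ∧ x = psi m) ∨ (0 ≤ m ∧ x = psiStar m)}

/-- The fermions `ψ_m` (`m ≥ 0`) and `ψ*_m` (`m < 0`), which span `W_cr`. -/
def creators : Set Fermions :=
  {x | ∃ m : ℤ, (0 ≤ m ∧ x = psi m) ∨ (m < 0 ∧ x = psiStar m)}

/-- The Fock space `F = A / A W_an`, a left module over the Clifford algebra `A`. -/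
abbrev Fock : Type := Fermions ⧸ (Submodule.span Fermions annihilators)

/-- The vacuum vector `|0⟩ = 1 mod A W_an`. -/
def vacuum : Fock := Submodule.Quotient.mk 1

theorem neg_twoPoint_toQuadraticMap :
    (-twoPoint).toQuadraticMap = (0 : QuadraticForm ℂ FreeFermion) - fermionForm := by
  ext w
  simp [twoPoint_self]

/-- The vacuum expectation value `a ↦ ⟨0| a |0⟩` on the Clifford algebra, as given by the Wick rule:
`a` is put in normal order with respect to the pairing `twoPoint` (this is the map `changeForm` to
the exterior algebra, which satisfies `N(w a) = w ∧ N(a) + ⟨0| w · |0⟩ ⌋ N(a)`), and the scalar part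
is taken. It is the unique linear form which is `1` at `1` and vanishes on `A W_an` and on `W_cr A`,
see `vev_one`, `vev_ι_mul_ι`, `vev_mul_annihilator`, `vev_creator_mul`. -/
def vev : Fermions →ₗ[ℂ] ℂ :=
  (ExteriorAlgebra.algebraMapInv (R := ℂ) (M := FreeFermion)).toLinearMap ∘ₗ
    CliffordAlgebra.changeForm neg_twoPoint_toQuadraticMap

theorem vev_one : vev 1 = 1 := by
  simp [vev]

theorem vev_ι_mul_ι (w w' : FreeFermion) :
    vev (CliffordAlgebra.ι fermionForm w * CliffordAlgebra.ι fermionForm w') = twoPoint w w' := by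
  have h : ∀ u : FreeFermion, ExteriorAlgebra.algebraMapInv
      (CliffordAlgebra.ι (0 : QuadraticForm ℂ FreeFermion) u) = (0 : ℂ) := by
    intro u
    simp [ExteriorAlgebra.algebraMapInv, ExteriorAlgebra.lift]
  rw [vev, LinearMap.comp_apply, CliffordAlgebra.changeForm_ι_mul_ι, AlgHom.toLinearMap_apply,
    map_sub, map_mul, h, AlgHom.commutes]
  simp

theorem vev_ι_mul (w : FreeFermion) (hw : ∀ w', twoPoint w w' = 0) (a : Fermions) :
    vev (CliffordAlgebra.ι fermionForm w * a) = 0 := by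
  have h0 : (-twoPoint) w = 0 := by
    ext w' <;> simp [hw]
  rw [vev, LinearMap.comp_apply, CliffordAlgebra.changeForm_ι_mul, h0]
  simp only [map_zero, LinearMap.zero_apply, sub_zero, AlgHom.toLinearMap_apply, map_mul]
  have : ExteriorAlgebra.algebraMapInv (CliffordAlgebra.ι (0 : QuadraticForm ℂ FreeFermion) w)
      = (0 : ℂ) := by
    simp [ExteriorAlgebra.algebraMapInv, ExteriorAlgebra.lift]
  rw [this, zero_mul]

theorem vev_mul_ι (w : FreeFermion) (hw : ∀ w', twoPoint w' w = 0) (a : Fermions) :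
    vev (a * CliffordAlgebra.ι fermionForm w) = 0 := by
  have hc : ∀ (d : Module.Dual ℂ FreeFermion) (_ : d w = 0)
      (x : CliffordAlgebra (0 : QuadraticForm ℂ FreeFermion)),
      CliffordAlgebra.contractLeft d (x * CliffordAlgebra.ι 0 w) =
        CliffordAlgebra.contractLeft d x * CliffordAlgebra.ι 0 w := by
    intro d hd x
    induction x using CliffordAlgebra.left_induction with
    | algebraMap r =>
      rw [CliffordAlgebra.contractLeft_algebraMap_mul, CliffordAlgebra.contractLeft_ι, hd,
        CliffordAlgebra.contractLeft_algebraMap]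
      simp
    | add x y hx hy => rw [add_mul, map_add, map_add, hx, hy, add_mul]
    | ι_mul x m hx =>
      rw [mul_assoc, CliffordAlgebra.contractLeft_ι_mul, CliffordAlgebra.contractLeft_ι_mul, hx,
        sub_mul, smul_mul_assoc, mul_assoc]
  have hN : CliffordAlgebra.changeForm neg_twoPoint_toQuadraticMap
      (a * CliffordAlgebra.ι fermionForm w) =
      CliffordAlgebra.changeForm neg_twoPoint_toQuadraticMap a * CliffordAlgebra.ι 0 w := by
    induction a using CliffordAlgebra.left_induction with
    | algebraMap r =>
      rw [← Algebra.smul_def, map_smul, CliffordAlgebra.changeForm_ι,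
        CliffordAlgebra.changeForm_algebraMap, Algebra.smul_def]
    | add x y hx hy => rw [add_mul, map_add, map_add, hx, hy, add_mul]
    | ι_mul x m hx =>
      rw [mul_assoc, CliffordAlgebra.changeForm_ι_mul, CliffordAlgebra.changeForm_ι_mul, hx,
        sub_mul, mul_assoc, hc _ (by simp [hw])]
  rw [vev, LinearMap.comp_apply, hN]
  simp only [AlgHom.toLinearMap_apply, map_mul]
  have : ExteriorAlgebra.algebraMapInv (CliffordAlgebra.ι (0 : QuadraticForm ℂ FreeFermion) w)
      = (0 : ℂ) := by
    simp [ExteriorAlgebra.algebraMapInv, ExteriorAlgebra.lift]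
  rw [this, mul_zero]

theorem vev_mul_annihilator (a x : Fermions) (hx : x ∈ annihilators) : vev (a * x) = 0 := by
  obtain ⟨m, ⟨hm, rfl⟩ | ⟨hm, rfl⟩⟩ := hx <;> refine vev_mul_ι _ (fun w' => ?_) a <;>
    rw [twoPoint_apply] <;> simp only [Finsupp.sum] <;> simp <;>
    refine Finset.sum_eq_zero fun i _ => ?_ <;>
    by_cases h : m = i <;> simp [h] <;> omega

theorem vev_creator_mul (a x : Fermions) (hx : x ∈ creators) : vev (x * a) = 0 := by
  obtain ⟨m, ⟨hm, rfl⟩ | ⟨hm, rfl⟩⟩ := hx <;> refine vev_ι_mul _ (fun w' => ?_) a <;>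
    rw [twoPoint_apply] <;> simp <;> omega

/-- The left vacuum `⟨0|`, as a linear form on Fock space: `⟨0| (a |0⟩) = ⟨0| a |0⟩`. -/
def leftVacuum : Fock →ₗ[ℂ] ℂ :=
  ((Submodule.span Fermions annihilators).restrictScalars ℂ).liftQ vev (by
    intro y hy
    rw [Submodule.restrictScalars_mem] at hy
    rw [LinearMap.mem_ker]
    induction hy using Submodule.span_induction with
    | mem x hx => simpa using vev_mul_annihilator 1 x hx
    | zero => exact map_zero _
    | add x y _ _ hx hy => rw [map_add, hx, hy, add_zero]
    | smul a x hx' _ =>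
      rw [smul_eq_mul]
      clear * - hx'
      have key : ∀ b : Fermions, vev (b * x) = 0 := by
        induction hx' using Submodule.span_induction with
        | mem x hx => exact fun b => vev_mul_annihilator b x hx
        | zero => simp
        | add x y _ _ hx hy => intro b; rw [mul_add, map_add, hx, hy, add_zero]
        | smul a x _ hx => intro b; rw [smul_eq_mul, ← mul_assoc]; exact hx _
      exact key a)

theorem leftVacuum_smul_vacuum (a : Fermions) : leftVacuum (a • vacuum) = vev a := by
  have : a • vacuum = (Submodule.Quotient.mk a : Fock) := by
    rw [vacuum, ← Submodule.Quotient.mk_smul, smul_eq_mul, mul_one]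
  rw [this]
  rfl

theorem annihilator_smul_vacuum (x : Fermions) (hx : x ∈ annihilators) : x • vacuum = 0 := by
  rw [vacuum, ← Submodule.Quotient.mk_smul, smul_eq_mul, mul_one, Submodule.Quotient.mk_eq_zero]
  exact Submodule.subset_span hx

/-! ## Operators on Fock space given by infinite sums -/

/-- The infinite sum `∑ j, a j` makes sense as an operator on Fock space: on each vector all but
finitely many terms vanish. -/
def ActsFinitely (a : ℤ → Fermions) : Prop :=
  ∀ v : Fock, (Function.support fun j => a j • v).Finite

/-- The operator `∑ j, a j` on Fock space. -/
def sumOp (a : ℤ → Fermions) (h : ActsFinitely a) : Module.End ℂ Fock where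
  toFun v := ∑ᶠ j, a j • v
  map_add' v w := by
    simp only [smul_add]
    exact finsum_add_distrib (h v) (h w)
  map_smul' c v := by
    simp only [RingHom.id_apply]
    rw [smul_finsum' c (h v)]
    exact finsum_congr fun j => smul_comm _ _ _

theorem actsFinitely_of_commute (a : ℤ → Fermions)
    (h0 : (Function.support fun j => a j • vacuum).Finite)
    (h : ∀ w : FreeFermion, {j | a j * CliffordAlgebra.ι fermionForm w ≠
      CliffordAlgebra.ι fermionForm w * a j}.Finite) : ActsFinitely a := by
  intro v
  obtain ⟨x, rfl⟩ := Submodule.Quotient.mk_surjective _ v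
  have hx : ∀ x : Fermions, (Submodule.Quotient.mk x : Fock) = x • vacuum := by
    intro x
    rw [vacuum, ← Submodule.Quotient.mk_smul, smul_eq_mul, mul_one]
  rw [hx]
  induction x using CliffordAlgebra.left_induction with
  | algebraMap r =>
    refine h0.subset fun j hj hj' => hj ?_
    have hj'' : a j • vacuum = 0 := hj'
    change a j • (algebraMap ℂ Fermions r • vacuum) = 0
    rw [smul_smul, ← Algebra.commutes, mul_smul, hj'', smul_zero]
  | add x y hx hy =>
    refine (hx.union hy).subset fun j hj => ?_
    by_contra hc
    simp only [Set.mem_union, Function.mem_support, not_or, not_not] at hc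
    apply hj
    change a j • ((x + y) • vacuum) = 0
    rw [add_smul, smul_add, hc.1, hc.2, add_zero]
  | ι_mul x w hx =>
    refine (hx.union (h w)).subset fun j hj => ?_
    by_contra hc
    simp only [Set.mem_union, Function.mem_support, not_or, not_not, Set.mem_ofPred_eq] at hc
    apply hj
    change a j • ((_ * x) • vacuum) = 0
    rw [mul_smul, smul_smul, hc.2, mul_smul, hc.1, smul_zero]

theorem anticomm_of_notMem (m : ℤ) (w : FreeFermion) :
    (m ∉ w.2.support → psi m * CliffordAlgebra.ι fermionForm w =
      -(CliffordAlgebra.ι fermionForm w * psi m)) ∧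
    (m ∉ w.1.support → psiStar m * CliffordAlgebra.ι fermionForm w =
      -(CliffordAlgebra.ι fermionForm w * psiStar m)) := by
  have aux : ∀ u u' : FreeFermion, QuadraticMap.polar fermionForm u u' =
      (u.1.sum fun m c => c * u'.2 m) + (u'.1.sum fun m c => c * u.2 m) := by
    intro u u'
    simp only [QuadraticMap.polar, fermionForm_apply, Prod.fst_add, Prod.snd_add]
    rw [Finsupp.sum_add_index' (by simp) (by intros; ring)]
    simp only [Finsupp.sum, mul_add, Finset.sum_add_distrib, Finsupp.add_apply]
    ring
  refine ⟨fun h => ?_, fun h => ?_⟩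
  · rw [eq_neg_iff_add_eq_zero, psi, CliffordAlgebra.ι_mul_ι_add_swap, aux]
    have h' : w.2 m = 0 := by simpa using h
    simp [h']
  · rw [eq_neg_iff_add_eq_zero, psiStar, CliffordAlgebra.ι_mul_ι_add_swap, aux]
    have h' : w.1 m = 0 := by simpa using h
    have h2 : (w.1.sum fun i c => c * (Finsupp.single m (1 : ℂ)) i) = 0 := by
      refine Finset.sum_eq_zero fun i _ => ?_
      by_cases hi : m = i
      · subst hi; simp [h']
      · simp [hi]
    simp only [h2, Finsupp.sum_zero_index, add_zero, map_zero]

theorem finite_not_commute (f g : ℤ → ℤ) (hf : f.Injective) (hg : g.Injective) (w : FreeFermion) :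
    {j | psi (f j) * psiStar (g j) * CliffordAlgebra.ι fermionForm w ≠
      CliffordAlgebra.ι fermionForm w * (psi (f j) * psiStar (g j))}.Finite := by
  have h1 : (f ⁻¹' (w.2.support : Set ℤ)).Finite :=
    w.2.support.finite_toSet.preimage hf.injOn
  have h2 : (g ⁻¹' (w.1.support : Set ℤ)).Finite :=
    w.1.support.finite_toSet.preimage hg.injOn
  refine (h1.union h2).subset fun j hj => ?_
  by_contra hc
  simp only [Set.mem_union, Set.mem_preimage, Finset.mem_coe, not_or] at hc
  apply hj
  rw [mul_assoc, (anticomm_of_notMem (g j) w).2 hc.2, mul_neg, ← mul_assoc,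
    (anticomm_of_notMem (f j) w).1 hc.1]
  simp only [neg_mul, neg_neg, mul_assoc]

theorem psi_mul_psiStar_of_ne {m n : ℤ} (h : m ≠ n) : psi m * psiStar n = -(psiStar n * psi m) := by
  rw [eq_neg_iff_add_eq_zero, psi_mul_psiStar, if_neg h]

theorem finite_smul_vacuum (f g : ℤ → ℤ) (hfg : ∀ j, f j ≠ g j)
    (hfin : {j | 0 ≤ f j ∧ g j < 0}.Finite) :
    (Function.support fun j => (psi (f j) * psiStar (g j)) • vacuum).Finite := by
  refine hfin.subset fun j hj => ?_
  by_contra hc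
  apply hj
  change (psi (f j) * psiStar (g j)) • vacuum = 0
  by_cases h : 0 ≤ g j
  · rw [mul_smul, annihilator_smul_vacuum _ ⟨g j, Or.inr ⟨h, rfl⟩⟩, smul_zero]
  · have h' : f j < 0 := by
      by_contra h''
      exact hc ⟨not_lt.mp h'', not_le.mp h⟩
    rw [psi_mul_psiStar_of_ne (hfg j), neg_smul, mul_smul,
      annihilator_smul_vacuum _ ⟨f j, Or.inl ⟨h', rfl⟩⟩, smul_zero, neg_zero]

theorem actsFinitely_H (k : ℤ) (hk : k ≠ 0) :
    ActsFinitely fun j => psi j * psiStar (j + k) := by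
  refine actsFinitely_of_commute _
    (finite_smul_vacuum (fun j => j) (fun j => j + k) (fun j => by simpa using hk) ?_)
    (finite_not_commute (fun j => j) (fun j => j + k) (fun _ _ h => h) (add_left_injective k))
  exact (Set.finite_Ico 0 (-k)).subset fun j hj => ⟨hj.1, by have := hj.2; linarith⟩

theorem actsFinitely_A (r : ℤ → ℂ) (k : ℕ+) : ActsFinitely fun j =>
    (∏ i ∈ Finset.range k, r (j - i)) • (psiStar (j - k) * psi j) := by
  have hk : ((k : ℕ) : ℤ) ≠ 0 := by exact_mod_cast k.pos.ne'
  have h := actsFinitely_of_commute _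
    (finite_smul_vacuum (fun j => j) (fun j => j - k) (fun j => by omega) ?_)
    (finite_not_commute (fun j => j) (fun j => j - k) (fun _ _ h => h) (sub_left_injective))
  · intro v
    refine (h v).subset fun j hj hj' => hj ?_
    have h1 : psiStar (j - k) * psi j = -(psi j * psiStar (j - k)) := by
      rw [psi_mul_psiStar_of_ne (by omega), neg_neg]
    have h2 : (psi j * psiStar (j - k)) • v = 0 := hj'
    change ((∏ i ∈ Finset.range k, r (j - i)) • (psiStar (j - k) * psi j)) • v = 0
    rw [h1, smul_assoc, neg_smul, h2, neg_zero, smul_zero]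
  · exact (Set.finite_Ico 0 ((k : ℕ) : ℤ)).subset fun j hj => ⟨hj.1, by have := hj.2; linarith⟩

/-- The operator `H_k = ∑ j, ψ_j ψ*_{j+k}` on Fock space, for `k = 1, 2, …`. -/
def opH (k : ℕ+) : Module.End ℂ Fock :=
  sumOp (fun j => psi j * psiStar (j + (k : ℤ))) (actsFinitely_H k (by exact_mod_cast k.pos.ne'))

/-- The operator `A_k = ∑ j, r(j) r(j-1) ⋯ r(j-k+1) ψ*_{j-k} ψ_j` on Fock space, `k = 1, 2, …`. -/
def opA (r : ℤ → ℂ) (k : ℕ+) : Module.End ℂ Fock :=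
  sumOp (fun j => (∏ i ∈ Finset.range k, r (j - i)) • (psiStar (j - k) * psi j))
    (actsFinitely_A r k)

/-! ## Charged vacua and the tau function -/

/-- `Ψ_n`, which is `ψ_{n-1} ⋯ ψ_1 ψ_0` for `n > 0`, `1` for `n = 0`, and `ψ*_n ⋯ ψ*_{-2} ψ*_{-1}`
for `n < 0`. -/
def bigPsi : ℤ → Fermions
  | Int.ofNat n => ((List.range n).reverse.map fun i : ℕ => psi i).prod
  | Int.negSucc n => ((List.range (n + 1)).reverse.map fun i : ℕ => psiStar (-(i : ℤ) - 1)).prod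

/-- `Ψ*_n`, which is `ψ*_0 ψ*_1 ⋯ ψ*_{n-1}` for `n > 0`, `1` for `n = 0`, and
`ψ_{-1} ψ_{-2} ⋯ ψ_n` for `n < 0`. -/
def bigPsiStar : ℤ → Fermions
  | Int.ofNat n => ((List.range n).map fun i : ℕ => psiStar i).prod
  | Int.negSucc n => ((List.range (n + 1)).map fun i : ℕ => psi (-(i : ℤ) - 1)).prod

/-- The expectation value `⟨n| X |n⟩ = ⟨0| Ψ*_n X Ψ_n |0⟩` of an operator on Fock space. -/
def expectation (n : ℤ) (X : Module.End ℂ Fock) : ℂ :=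
  leftVacuum (bigPsiStar n • X (bigPsi n • vacuum))

/-- `e^{H(t)}` with `H(t) = ∑ t_m H_m`, a formal series in `t_1, t_2, …` whose coefficients are
operators on Fock space. -/
def expH : MvPowerSeries ℕ+ (Module.End ℂ Fock) := formalExp (linearSeries opH)

/-- `e^{-A(t*)}` with `A(t*) = ∑ t*_m A_m`, a formal series in `t*_1, t*_2, …` whose coefficients
are operators on Fock space. -/
def expNegA (r : ℤ → ℂ) : MvPowerSeries ℕ+ (Module.End ℂ Fock) :=
  formalExp (-linearSeries (opA r))

/-- The tau function `τ_r(n, t, t*) = ⟨n| e^{H(t)} e^{-A(t*)} |n⟩`, a formal series in the variables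
`t_m` (left summand) and `t*_m` (right summand). -/
def tau (r : ℤ → ℂ) (n : ℤ) : MvPowerSeries (ℕ+ ⊕ ℕ+) ℂ :=
  pairSeries (fun X Y => expectation n (X * Y)) expH (expNegA r)

end

end HypTau

namespace HypTau

noncomputable section

/-! ## Coefficients of the exponential of a linear series -/

/-! The anti-automorphism exchanging `ψ_m` and `ψ*_m` gives a bilinear form on Fock space for which
`⟨n| X |n⟩` is the pairing of `|n⟩` with `X |n⟩`. In it the wedge vectors `v_λ = ψ_{a_1} ⋯ ψ_{a_N}
|n - N⟩`, `a_i = n - i + λ_i`, are orthonormal, and they span the sector of charge `n`.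

The adjoint of `-A_m` lowers one level of a wedge vector by `m`, with weight `r(a) r(a-1) ⋯
r(a-m+1)` when it moves `a` to `a - m`. On the other side `∂h_k/∂γ_m = h_{k-m}`, so `∂/∂γ_m` lowers
one row index of a Schur determinant by `m`. The weights are accounted for by the product of `r`
over all levels crossed above the vacuum (`levelProd`), which for a partition is `r_λ(n)`. Hence a
wedge vector corresponds to `levelProd` times its determinant, the adjoint of `-A_m` to `∂/∂γ_m`
(`wedgeRel_step`), and pairing with `|n⟩` to evaluation at `γ = 0`. Taylor's formula then gives `⟨n,
exp(∑ t_m (-A_m)†) v_λ⟩ = r_λ(n) s_λ(t)` (`fockForm_vac_opAdj_schurVec`). Moved to the other side,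
this says that `e^{-A(t*)} |n⟩` has coordinates `r_λ(n) s_λ(t*)`; for `r = 1` it says that `⟨n|
e^{H(t)} v_λ = s_λ(t)`. Together they give the Schur expansion (`coeff_tau`).

For the scalar product one needs the Cauchy identity `exp(∑ m t_m γ_m) = ∑ s_λ(t) s_λ(γ)`. It comes
from computing the case `r = 1` a second time: by the Heisenberg relation (`shiftOp_commute`), `H_m`
and its adjoint `B_m` act on words `B_{k_1} ⋯ B_{k_l} |n⟩` as `∂/∂γ_m` and multiplication by `m
γ_m`. Comparing the two computations gives `coeff_expGamma`, and the deformed form evaluates it to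
the same sum.

Both correspondences are kept as linear relations, that is submodules of `Fock × SymFun`, rather
than maps. Their generators are redundant, and no well-definedness has to be checked. No division by
values of `r` occurs, so `r` may vanish. -/

theorem coeff_linearSeries {σ R : Type*} [Semiring R] (a : σ → R) (d : σ →₀ ℕ) :
    MvPowerSeries.coeff d (linearSeries a) =
      open Classical in ∑ i ∈ d.support, if d = Finsupp.single i 1 then a i else 0 := rfl

theorem coeff_linearSeries_single {σ R : Type*} [Semiring R] (a : σ → R) (i : σ) :
    MvPowerSeries.coeff (Finsupp.single i 1) (linearSeries a) = a i := by
  rw [coeff_linearSeries, Finsupp.support_single]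
  · simp
  · exact one_ne_zero

theorem coeff_linearSeries_of_ne {σ R : Type*} [Semiring R] (a : σ → R) (d : σ →₀ ℕ)
    (h : ∀ i, d ≠ Finsupp.single i 1) : MvPowerSeries.coeff d (linearSeries a) = 0 := by
  rw [coeff_linearSeries]
  exact Finset.sum_eq_zero fun i _ => if_neg (h i)

theorem single_one_le_of_mem {σ : Type*} {d : σ →₀ ℕ} {i : σ} (h : i ∈ d.support) :
    Finsupp.single i 1 ≤ d :=
  Finsupp.single_le_iff.mpr (Nat.one_le_iff_ne_zero.mpr (Finsupp.mem_support_iff.mp h))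

theorem coeff_linearSeries_mul {σ R : Type*} [Semiring R] (a : σ → R) (f : MvPowerSeries σ R)
    (d : σ →₀ ℕ) : MvPowerSeries.coeff d (linearSeries a * f) =
      ∑ i ∈ d.support, a i * MvPowerSeries.coeff (d - Finsupp.single i 1) f := by
  classical
  rw [MvPowerSeries.coeff_mul]
  symm
  refine Finset.sum_of_injOn (fun i => (Finsupp.single i 1, d - Finsupp.single i 1)) ?_ ?_ ?_ ?_
  · intro i _ j _ h
    exact Finsupp.single_left_injective one_ne_zero (congrArg Prod.fst h)
  · intro i hi
    simpa using add_tsub_cancel_of_le (single_one_le_of_mem hi)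
  · rintro ⟨p, q⟩ hp hn
    rw [coeff_linearSeries_of_ne, zero_mul]
    rintro i rfl
    have hp : Finsupp.single i 1 + q = d := by simpa using hp
    refine hn ⟨i, ?_, ?_⟩
    · simp [← hp]
    · simp [← hp]
  · intro i _
    simp only [coeff_linearSeries_single]

theorem coeff_mul_linearSeries {σ R : Type*} [Semiring R] (a : σ → R) (f : MvPowerSeries σ R)
    (d : σ →₀ ℕ) : MvPowerSeries.coeff d (f * linearSeries a) =
      ∑ i ∈ d.support, MvPowerSeries.coeff (d - Finsupp.single i 1) f * a i := by
  classical
  rw [MvPowerSeries.coeff_mul]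
  symm
  refine Finset.sum_of_injOn (fun i => (d - Finsupp.single i 1, Finsupp.single i 1)) ?_ ?_ ?_ ?_
  · intro i _ j _ h
    exact Finsupp.single_left_injective one_ne_zero (congrArg Prod.snd h)
  · intro i hi
    simpa using tsub_add_cancel_of_le (single_one_le_of_mem hi)
  · rintro ⟨p, q⟩ hp hn
    rw [coeff_linearSeries_of_ne, mul_zero]
    rintro i rfl
    have hp : p + Finsupp.single i 1 = d := by simpa using hp
    refine hn ⟨i, ?_, ?_⟩
    · simp [← hp]
    · simp [← hp]
  · intro i _
    simp only [coeff_linearSeries_single]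

theorem degree_sub_single {σ : Type*} {d : σ →₀ ℕ} {i : σ} (h : i ∈ d.support) :
    (d - Finsupp.single i 1).degree + 1 = d.degree := by
  conv_rhs => rw [← tsub_add_cancel_of_le (single_one_le_of_mem h), map_add]
  simp

theorem coeff_linearSeries_pow_of_ne {σ R : Type*} [Semiring R] (a : σ → R) (k : ℕ)
    (d : σ →₀ ℕ) (h : d.degree ≠ k) : MvPowerSeries.coeff d (linearSeries a ^ k) = 0 := by
  classical
  induction k generalizing d with
  | zero =>
    rw [pow_zero, MvPowerSeries.coeff_one, if_neg]
    rintro rfl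
    simp at h
  | succ k ih =>
    rw [pow_succ', coeff_linearSeries_mul]
    refine Finset.sum_eq_zero fun i hi => ?_
    rw [ih, mul_zero]
    have := degree_sub_single hi
    omega

theorem coeff_formalExp_linearSeries {σ R : Type*} [Semiring R] [Algebra ℂ R] (a : σ → R)
    (d : σ →₀ ℕ) : MvPowerSeries.coeff d (formalExp (linearSeries a)) =
      ((d.degree.factorial : ℂ)⁻¹) • MvPowerSeries.coeff d (linearSeries a ^ d.degree) := by
  change ∑ k ∈ Finset.range (d.degree + 1), _ = _
  refine Finset.sum_eq_single_of_mem _ (by simp) fun k _ hk => ?_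
  rw [coeff_linearSeries_pow_of_ne _ _ _ hk.symm, smul_zero]

theorem coeff_zero_formalExp {σ R : Type*} [Semiring R] [Algebra ℂ R] (a : σ → R) :
    MvPowerSeries.coeff 0 (formalExp (linearSeries a)) = 1 := by
  rw [coeff_formalExp_linearSeries]
  simp

/-- Only `x ^ k / k!` with `k = |d|` meets the exponent `d`, since `x` is homogeneous of degree one;
splitting off its first factor gives this Euler-type recursion. It needs no commutation among the `a
i`, unlike differentiation in a single variable. -/
theorem degree_smul_coeff_formalExp_left {σ R : Type*} [Semiring R] [Algebra ℂ R] (a : σ → R)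
    (d : σ →₀ ℕ) : (d.degree : ℂ) • MvPowerSeries.coeff d (formalExp (linearSeries a)) =
      ∑ i ∈ d.support,
        a i * MvPowerSeries.coeff (d - Finsupp.single i 1) (formalExp (linearSeries a)) := by
  rcases hk : d.degree with _ | k
  · have : d = 0 := (Finsupp.degree_eq_zero_iff d).mp hk
    simp [this]
  · rw [coeff_formalExp_linearSeries, hk, pow_succ', coeff_linearSeries_mul, smul_smul,
      Nat.factorial_succ, Nat.cast_mul, mul_inv, ← mul_assoc,
      mul_inv_cancel₀ (Nat.cast_ne_zero.mpr k.succ_ne_zero), one_mul, Finset.smul_sum]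
    refine Finset.sum_congr rfl fun i hi => ?_
    have h : (d - Finsupp.single i 1).degree = k := by
      have := degree_sub_single hi
      omega
    rw [coeff_formalExp_linearSeries, h, mul_smul_comm]

/-- Splits off the last factor instead of the first. Both versions are needed because adjunction
reverses products. -/
theorem degree_smul_coeff_formalExp_right {σ R : Type*} [Semiring R] [Algebra ℂ R] (a : σ → R)
    (d : σ →₀ ℕ) : (d.degree : ℂ) • MvPowerSeries.coeff d (formalExp (linearSeries a)) =
      ∑ i ∈ d.support,
        MvPowerSeries.coeff (d - Finsupp.single i 1) (formalExp (linearSeries a)) * a i := by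
  rcases hk : d.degree with _ | k
  · have : d = 0 := (Finsupp.degree_eq_zero_iff d).mp hk
    simp [this]
  · rw [coeff_formalExp_linearSeries, hk, pow_succ, coeff_mul_linearSeries, smul_smul,
      Nat.factorial_succ, Nat.cast_mul, mul_inv, ← mul_assoc,
      mul_inv_cancel₀ (Nat.cast_ne_zero.mpr k.succ_ne_zero), one_mul, Finset.smul_sum]
    refine Finset.sum_congr rfl fun i hi => ?_
    have h : (d - Finsupp.single i 1).degree = k := by
      have := degree_sub_single hi
      omega
    rw [coeff_formalExp_linearSeries, h, smul_mul_assoc]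

/-- Induction on the degree of a monomial exponent, removing one variable at a time. -/
theorem exponent_induction {σ : Type*} {P : (σ →₀ ℕ) → Prop} (zero : P 0)
    (step : ∀ d, (d.degree : ℂ) ≠ 0 → (∀ i ∈ d.support, P (d - Finsupp.single i 1)) → P d)
    (d : σ →₀ ℕ) : P d := by
  induction hk : d.degree generalizing d with
  | zero => rwa [(Finsupp.degree_eq_zero_iff d).mp hk]
  | succ k ih =>
    refine step d (by rw [hk]; exact Nat.cast_ne_zero.mpr k.succ_ne_zero) fun i hi => ih _ ?_
    have := degree_sub_single hi
    omega

/-- If a linear form `ε` and operators `H_m` on `V` correspond to evaluation at zero and to the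
derivations `∂/∂γ_m` under a linear relation `S` between `V` and `Λ`, then `ε ∘ e^{H(t)}` is the
Taylor expansion. -/
theorem formalExp_apply_of_rel {V : Type*} [AddCommGroup V] [Module ℂ V]
    (H : ℕ+ → Module.End ℂ V) (S : Submodule ℂ (V × SymFun)) (ε : V →ₗ[ℂ] ℂ)
    (hS : ∀ m p, p ∈ S → (H m p.1, MvPolynomial.pderiv m p.2) ∈ S)
    (hε : ∀ p, p ∈ S → ε p.1 = MvPolynomial.coeff 0 p.2) (d : ℕ+ →₀ ℕ) :
    ∀ p, p ∈ S → ε (MvPowerSeries.coeff d (formalExp (linearSeries H)) p.1) =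
      MvPolynomial.coeff d p.2 := by
  induction d using exponent_induction with
  | zero =>
    intro p hp
    rw [coeff_zero_formalExp, Module.End.one_apply, hε p hp]
  | step d hd ih =>
    intro p hp
    refine smul_right_injective ℂ hd ?_
    change (d.degree : ℂ) • _ = (d.degree : ℂ) • _
    rw [← map_smul, ← LinearMap.smul_apply, degree_smul_coeff_formalExp_right,
      LinearMap.sum_apply, map_sum, smul_eq_mul, Finsupp.degree_apply, Nat.cast_sum,
      Finset.sum_mul]
    -- Differentiating in the `i`-th variable multiplies the coefficient at `d` by `d i`, and the `d
    -- i` add up to the degree.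
    refine Finset.sum_congr rfl fun i hi => ?_
    have hi' : 1 ≤ d i := Nat.one_le_iff_ne_zero.mpr (Finsupp.mem_support_iff.mp hi)
    rw [Module.End.mul_apply, ih i hi _ (hS i p hp), MvPolynomial.coeff_pderiv,
      tsub_add_cancel_of_le (single_one_le_of_mem hi), Finsupp.tsub_apply,
      Finsupp.single_eq_same, mul_comm]
    congr 1
    norm_cast
    omega

/-- Exponentials of operators which are adjoint for a pairing are adjoint. -/
theorem formalExp_adjoint {V : Type*} [AddCommGroup V] [Module ℂ V]
    (B : V →ₗ[ℂ] V →ₗ[ℂ] ℂ) (X Y : ℕ+ → Module.End ℂ V)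
    (h : ∀ m x y, B (X m x) y = B x (Y m y)) (d : ℕ+ →₀ ℕ) : ∀ x y,
    B (MvPowerSeries.coeff d (formalExp (linearSeries X)) x) y =
      B x (MvPowerSeries.coeff d (formalExp (linearSeries Y)) y) := by
  induction d using exponent_induction with
  | zero => intro x y; rw [coeff_zero_formalExp, coeff_zero_formalExp]; rfl
  | step d hd ih =>
    intro x y
    refine smul_right_injective ℂ hd ?_
    have e1 : ∀ (c : ℂ) (Z : Module.End ℂ V), c • B (Z x) y = B ((c • Z) x) y := by
      intro c Z
      rw [LinearMap.smul_apply, map_smul, LinearMap.smul_apply]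
    have e2 : ∀ (c : ℂ) (Z : Module.End ℂ V), c • B x (Z y) = B x ((c • Z) y) := by
      intro c Z
      rw [LinearMap.smul_apply, map_smul]
    change (d.degree : ℂ) • _ = (d.degree : ℂ) • _
    rw [e1, e2,
      degree_smul_coeff_formalExp_right, degree_smul_coeff_formalExp_left, LinearMap.sum_apply,
      LinearMap.sum_apply, map_sum, map_sum, LinearMap.sum_apply]
    refine Finset.sum_congr rfl fun i hi => ?_
    rw [Module.End.mul_apply, Module.End.mul_apply, ih i hi, h]

/-- A submodule which is stable under a family of operators is stable under the
coefficients of the exponential. -/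
theorem formalExp_mem {V : Type*} [AddCommGroup V] [Module ℂ V]
    (X : ℕ+ → Module.End ℂ V) (S : Submodule ℂ V) (h : ∀ m x, x ∈ S → X m x ∈ S)
    {x : V} (hx : x ∈ S) (d : ℕ+ →₀ ℕ) :
    MvPowerSeries.coeff d (formalExp (linearSeries X)) x ∈ S := by
  induction d using exponent_induction with
  | zero => rw [coeff_zero_formalExp]; exact hx
  | step d hd ih =>
    rw [← S.smul_mem_iff hd, ← LinearMap.smul_apply, degree_smul_coeff_formalExp_left,
      LinearMap.sum_apply]
    exact S.sum_mem fun i hi => h i _ (ih i hi)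

theorem formalExp_neg_linearSeries {σ R : Type*} [Ring R] [Algebra ℂ R] (a : σ → R) :
    formalExp (-linearSeries a) = formalExp (linearSeries fun i => -a i) := by
  congr 1
  ext d
  rw [map_neg, coeff_linearSeries, coeff_linearSeries, ← Finset.sum_neg_distrib]
  refine Finset.sum_congr rfl fun i _ => ?_
  split_ifs <;> simp

/-! ## Derivatives of symmetric functions -/

theorem derivation_prod {ι A : Type*} [CommRing A] [Algebra ℂ A] (D : Derivation ℂ A A)
    [DecidableEq ι] (s : Finset ι) (f : ι → A) :
    D (∏ i ∈ s, f i) = ∑ i ∈ s, (∏ j ∈ s.erase i, f j) * D (f i) := by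
  induction s using Finset.induction_on with
  | empty => simp
  | insert a s ha ih =>
    rw [Finset.prod_insert ha, Derivation.leibniz, ih, Finset.sum_insert ha,
      Finset.erase_insert ha, smul_eq_mul, smul_eq_mul, Finset.mul_sum, add_comm]
    congr 1
    · refine Finset.sum_congr rfl fun i hi => ?_
      have hia : a ≠ i := fun h => ha (h ▸ hi)
      rw [Finset.erase_insert_of_ne hia, Finset.prod_insert (fun h => ha (Finset.mem_of_mem_erase h)),
        mul_assoc]

/-- Leibniz rule applied to each product in the expansion of the determinant, grouped by the row
that is differentiated. -/
theorem derivation_det {ι A : Type*} [CommRing A] [Algebra ℂ A] (D : Derivation ℂ A A)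
    [DecidableEq ι] [Fintype ι] (M : Matrix ι ι A) :
    D M.det = ∑ i, (M.updateRow i fun j => D (M i j)).det := by
  -- Transposed expansion, so that the factors of each product are indexed by rows.
  have h : ∀ N : Matrix ι ι A, N.det = ∑ σ : Equiv.Perm ι, Equiv.Perm.sign σ • ∏ i, N i (σ i) := by
    intro N
    rw [← Matrix.det_transpose, Matrix.det_apply]
    rfl
  rw [h, map_sum]
  simp_rw [h]
  rw [Finset.sum_comm]
  refine Finset.sum_congr rfl fun σ _ => ?_
  rw [Units.smul_def, map_zsmul, derivation_prod, Finset.smul_sum]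
  refine Finset.sum_congr rfl fun i _ => ?_
  rw [Units.smul_def, ← Finset.mul_prod_erase _ _ (Finset.mem_univ i), Matrix.updateRow_self,
    mul_comm]
  congr 2
  refine Finset.prod_congr rfl fun j hj => ?_
  rw [Matrix.updateRow_ne (Finset.ne_of_mem_erase hj)]

/-- A derivation of `Λ` applied to the coefficients of a power series. -/
def coeffDeriv (m : ℕ+) (f : PowerSeries SymFun) : PowerSeries SymFun :=
  PowerSeries.mk fun k => MvPolynomial.pderiv m (PowerSeries.coeff k f)

theorem coeffDeriv_mul (m : ℕ+) (f g : PowerSeries SymFun) :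
    coeffDeriv m (f * g) = f * coeffDeriv m g + g * coeffDeriv m f := by
  ext1 k
  rw [mul_comm g]
  simp only [coeffDeriv, PowerSeries.coeff_mk, PowerSeries.coeff_mul, map_add, map_sum,
    Derivation.leibniz, ← Finset.sum_add_distrib, smul_eq_mul]
  exact Finset.sum_congr rfl fun p _ => by ring

theorem coeffDeriv_xi (m : ℕ+) : coeffDeriv m xi = PowerSeries.X ^ (m : ℕ) := by
  ext1 k
  rw [coeffDeriv, PowerSeries.coeff_mk, xi, PowerSeries.coeff_mk, PowerSeries.coeff_X_pow]
  split_ifs with h1 h2 h2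
  · have : k.toPNat h1 = m := PNat.eq h2
    rw [this, MvPolynomial.pderiv_X_self]
  · rw [MvPolynomial.pderiv_X_of_ne]
    intro h
    exact h2 (congrArg PNat.val h)
  · exact absurd m.pos (by omega)
  · exact map_zero _

theorem coeffDeriv_xi_pow (m : ℕ+) (j : ℕ) : coeffDeriv m (xi ^ (j + 1)) =
    ((j : ℂ) + 1) • (PowerSeries.X ^ (m : ℕ) * xi ^ j) := by
  induction j with
  | zero => simp [coeffDeriv_xi]
  | succ j ih =>
    rw [pow_succ, coeffDeriv_mul, ih, coeffDeriv_xi, pow_succ, mul_smul_comm, Nat.cast_succ,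
      mul_comm (xi ^ j * xi), mul_left_comm xi]
    simp only [mul_comm xi (xi ^ j), add_smul, one_smul]
    rw [add_comm]

theorem constantCoeff_xi : PowerSeries.coeff 0 xi = 0 := by
  rw [xi, PowerSeries.coeff_mk, dif_neg (lt_irrefl 0)]

/-- With `ξ = ∑ γ_m z ^ m`, this is the coefficient of `z ^ k` in `∂ exp ξ / ∂γ_m = z ^ m exp ξ`. -/
theorem pderiv_complete (m : ℕ+) (k : ℕ) : MvPolynomial.pderiv m (complete k) =
    completeInt ((k : ℤ) - (m : ℕ)) := by
  have h1 : MvPolynomial.pderiv m (complete k) = ∑ j ∈ Finset.range k,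
      ((j.factorial : ℂ)⁻¹) • PowerSeries.coeff k (PowerSeries.X ^ (m : ℕ) * xi ^ j) := by
    rw [complete_eq, map_sum, Finset.sum_range_succ']
    have h0 : (MvPolynomial.pderiv m) ((((0 : ℕ).factorial : ℂ)⁻¹) •
        PowerSeries.coeff k (xi ^ 0)) = 0 := by
      rw [pow_zero, PowerSeries.coeff_one, Derivation.map_smul]
      split_ifs <;> simp
    rw [h0, add_zero]
    refine Finset.sum_congr rfl fun j _ => ?_
    have h2 : MvPolynomial.pderiv m (PowerSeries.coeff k (xi ^ (j + 1))) =
        PowerSeries.coeff k (coeffDeriv m (xi ^ (j + 1))) := by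
      rw [coeffDeriv, PowerSeries.coeff_mk]
    have hs : ∀ (c : ℂ) (f : PowerSeries SymFun),
        PowerSeries.coeff k (c • f) = c • PowerSeries.coeff k f := fun _ _ => rfl
    have h3 : ((j : ℂ) + 1) ≠ 0 := by exact_mod_cast j.succ_ne_zero
    rw [Derivation.map_smul, h2, coeffDeriv_xi_pow, hs, smul_smul, Nat.factorial_succ]
    congr 1
    push_cast
    field_simp
  rw [h1]
  by_cases hk : (m : ℕ) ≤ k
  · obtain ⟨l, rfl⟩ := Nat.exists_eq_add_of_le' hk
    have h4 : ((l + (m : ℕ) : ℕ) : ℤ) - (m : ℕ) = Int.ofNat l := by simp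
    rw [h4, completeInt, complete_eq]
    -- The powers `ξ ^ j` with `j > l` have no term `z ^ l`, so the sum shortens to the one defining
    -- `h_l`.
    have h5 : Finset.range (l + 1) ⊆ Finset.range (l + m) := by
      have := m.pos
      exact Finset.range_mono (by omega)
    rw [← Finset.sum_subset h5]
    · refine Finset.sum_congr rfl fun j _ => ?_
      rw [PowerSeries.coeff_X_pow_mul]
    · intro j _ hj
      rw [PowerSeries.coeff_X_pow_mul]
      have hj : l < j := by simpa using hj
      have := coeff_pow_eq_zero_of_degree_lt (σ := Unit) xi
        ((PowerSeries.coeff_zero_eq_constantCoeff_apply xi).symm.trans constantCoeff_xi) j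
        (Finsupp.single () l) (by simpa using hj)
      rw [show PowerSeries.coeff l (xi ^ j) = 0 from this, smul_zero]
  · obtain ⟨l, hl⟩ := Int.eq_negSucc_of_lt_zero (show (k : ℤ) - (m : ℕ) < 0 by omega)
    rw [hl, completeInt]
    refine Finset.sum_eq_zero fun j _ => ?_
    rw [PowerSeries.coeff_X_pow_mul', if_neg hk, smul_zero]

theorem pderiv_completeInt (m : ℕ+) (k : ℤ) : MvPolynomial.pderiv m (completeInt k) =
    completeInt (k - (m : ℕ)) := by
  rcases k with k | k
  · exact pderiv_complete m k
  · obtain ⟨l, hl⟩ := Int.eq_negSucc_of_lt_zero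
      (show Int.negSucc k - (m : ℕ) < 0 by have := Int.negSucc_lt_zero k; omega)
    rw [hl]
    exact map_zero _

theorem completeInt_of_neg {k : ℤ} (hk : k < 0) : completeInt k = 0 := by
  obtain ⟨l, hl⟩ := Int.eq_negSucc_of_lt_zero hk
  rw [hl]
  rfl

/-- At `γ = 0` the generating function of the `h_k` is `exp 0 = 1`. -/
theorem coeff_zero_completeInt (k : ℤ) :
    MvPolynomial.coeff 0 (completeInt k) = if k = 0 then 1 else 0 := by
  rcases k with k | k
  · change MvPolynomial.coeff 0 (complete k) = _
    rw [← MvPolynomial.constantCoeff_eq, complete_eq, map_sum, Finset.sum_range_succ']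
    have h : ∀ j, MvPolynomial.constantCoeff (PowerSeries.coeff k (xi ^ (j + 1))) = 0 := by
      intro j
      rw [← PowerSeries.coeff_map, map_pow]
      have : PowerSeries.map MvPolynomial.constantCoeff xi = 0 := by
        ext1 l
        rw [PowerSeries.coeff_map, xi, PowerSeries.coeff_mk]
        split_ifs <;> simp
      rw [this]
      simp
    have h' : ∀ (c : ℂ) (f : SymFun), MvPolynomial.constantCoeff (c • f) =
        c * MvPolynomial.constantCoeff f := by
      intro c f
      simp [MvPolynomial.smul_eq_C_mul]
    simp only [h', h, mul_zero, Finset.sum_const_zero, zero_add, pow_zero]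
    rw [PowerSeries.coeff_one]
    by_cases hk : k = 0
    · simp [hk]
    · simp [hk]
  · rw [if_neg (by omega)]
    rfl

/-- The determinant `det (h_{a_i - n + 1 + j})`, `0 ≤ i, j < N`. For `a_i = n - 1 - i + λ_i` this is
the Schur function `s_λ`. -/
def schurDet (n : ℤ) {N : ℕ} (a : Fin N → ℤ) : SymFun :=
  Matrix.det (Matrix.of fun i j : Fin N => completeInt (a i - n + 1 + (j : ℤ)))

/-- Row `i` involves only `a i`, and differentiating `h` shifts its index, so differentiating a row
amounts to lowering `a i`. `shiftOp_listVec` is the fermionic counterpart. -/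
theorem pderiv_schurDet (m : ℕ+) (n : ℤ) {N : ℕ} (a : Fin N → ℤ) :
    MvPolynomial.pderiv m (schurDet n a) =
      ∑ i, schurDet n (Function.update a i (a i - (m : ℕ))) := by
  rw [schurDet, derivation_det]
  refine Finset.sum_congr rfl fun i _ => ?_
  rw [schurDet]
  congr 1
  ext1 i' j
  by_cases h : i' = i
  · subst h
    simp only [Matrix.updateRow_self, Matrix.of_apply, pderiv_completeInt, Function.update_self]
    congr 1
    ring
  · simp only [Matrix.updateRow_ne h, Matrix.of_apply, Function.update_of_ne h]

theorem coeff_zero_schurDet (n : ℤ) {N : ℕ} (a : Fin N → ℤ) :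
    MvPolynomial.coeff 0 (schurDet n a) =
      Matrix.det (Matrix.of fun i j : Fin N => if a i = n - 1 - j then (1 : ℂ) else 0) := by
  rw [← MvPolynomial.constantCoeff_eq, schurDet, RingHom.map_det]
  congr 1
  ext1 i j
  simp only [RingHom.mapMatrix_apply, Matrix.map_apply, Matrix.of_apply,
    MvPolynomial.constantCoeff_eq, coeff_zero_completeInt]
  refine if_congr ?_ rfl rfl
  constructor <;> intro h <;> linarith

/-- The largest index in row `i` is `a i - n + N < 0`, so the row vanishes. This and the vanishing
for repeated entries match `listVec_eq_zero`. -/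
theorem schurDet_eq_zero_of_lt (n : ℤ) {N : ℕ} (a : Fin N → ℤ) (i : Fin N) (h : a i < n - N) :
    schurDet n a = 0 := by
  refine Matrix.det_eq_zero_of_row_eq_zero i fun j => ?_
  have := j.isLt
  exact completeInt_of_neg (by omega)

theorem schurDet_eq_zero_of_not_injective (n : ℤ) {N : ℕ} (a : Fin N → ℤ)
    (h : ¬ Function.Injective a) : schurDet n a = 0 := by
  rw [Function.not_injective_iff] at h
  obtain ⟨i, j, hij, hne⟩ := h
  refine Matrix.det_zero_of_row_eq hne ?_
  ext1 k
  simp [hij]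

theorem schur_eq_schurDet (n : ℤ) (μ : YoungDiagram) :
    schur μ = schurDet n fun i : Fin (μ.colLen 0) => n - 1 - i + μ.rowLen i := by
  rw [schur, schurDet]
  congr 1
  ext1 i j
  simp only [Matrix.of_apply]
  congr 1
  ring

/-! ## The canonical bilinear form on Fock space -/

/-- The isometry exchanging `ψ_m` and `ψ*_m`. -/
def swapFermion : fermionForm →qᵢ fermionForm where
  toLinearMap := (LinearEquiv.prodComm ℂ (ℤ →₀ ℂ) (ℤ →₀ ℂ)).toLinearMap
  map_app' w := by
    change fermionForm (w.2, w.1) = fermionForm w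
    rw [fermionForm_apply, fermionForm_apply,
      Finsupp.sum_of_support_subset (s := w.1.support ∪ w.2.support) w.2
        Finset.subset_union_right _ (by simp),
      Finsupp.sum_of_support_subset (s := w.1.support ∪ w.2.support) w.1
        Finset.subset_union_left _ (by simp)]
    exact Finset.sum_congr rfl fun i _ => mul_comm _ _

/-- The linear anti-automorphism of the Clifford algebra exchanging `ψ_m` and `ψ*_m`. -/
def dagger : Fermions →ₗ[ℂ] Fermions :=
  CliffordAlgebra.reverse ∘ₗ (CliffordAlgebra.map swapFermion).toLinearMap

theorem dagger_mul (a b : Fermions) : dagger (a * b) = dagger b * dagger a := by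
  simp [dagger, CliffordAlgebra.reverse.map_mul]

theorem dagger_one : dagger 1 = 1 := by
  simp [dagger]

theorem dagger_psi (m : ℤ) : dagger (psi m) = psiStar m := by
  simp only [dagger, psi, psiStar, LinearMap.comp_apply, AlgHom.toLinearMap_apply,
    CliffordAlgebra.map_apply_ι, CliffordAlgebra.reverse_ι]
  rfl

theorem dagger_psiStar (m : ℤ) : dagger (psiStar m) = psi m := by
  simp only [dagger, psi, psiStar, LinearMap.comp_apply, AlgHom.toLinearMap_apply,
    CliffordAlgebra.map_apply_ι, CliffordAlgebra.reverse_ι]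
  rfl

/-- This is why the form `fockForm` descends to the quotient by the left ideal of the annihilators:
the left vacuum kills creators. -/
theorem dagger_mem_creators {x : Fermions} (hx : x ∈ annihilators) : dagger x ∈ creators := by
  obtain ⟨m, ⟨hm, rfl⟩ | ⟨hm, rfl⟩⟩ := hx
  · exact ⟨m, Or.inr ⟨hm, dagger_psi m⟩⟩
  · exact ⟨m, Or.inl ⟨hm, dagger_psiStar m⟩⟩

theorem mk_eq_smul_vacuum (a : Fermions) : (Submodule.Quotient.mk a : Fock) = a • vacuum := by
  rw [vacuum, ← Submodule.Quotient.mk_smul, smul_eq_mul, mul_one]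

/-- The linear form `y ↦ ⟨0| a† y` on Fock space. -/
def daggerForm : Fermions →ₗ[ℂ] Fock →ₗ[ℂ] ℂ :=
  (LinearMap.llcomp ℂ Fock Fock ℂ leftVacuum) ∘ₗ
    ((Algebra.lsmul ℂ ℂ Fock).toLinearMap ∘ₗ dagger)

theorem daggerForm_apply (a : Fermions) (y : Fock) :
    daggerForm a y = leftVacuum (dagger a • y) := rfl

/-- The bilinear form on Fock space with `⟨a|0⟩, y⟩ = ⟨0| a† y`. -/
def fockForm : Fock →ₗ[ℂ] Fock →ₗ[ℂ] ℂ :=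
  ((Submodule.span Fermions annihilators).restrictScalars ℂ).liftQ daggerForm (by
    intro y hy
    rw [Submodule.restrictScalars_mem] at hy
    rw [LinearMap.mem_ker]
    induction hy using Submodule.span_induction with
    | zero => exact map_zero _
    | add x y _ _ hx hy => rw [map_add, hx, hy, add_zero]
    | mem x hx =>
      refine LinearMap.ext fun v => ?_
      obtain ⟨b, rfl⟩ := Submodule.Quotient.mk_surjective _ v
      rw [daggerForm_apply, mk_eq_smul_vacuum, smul_smul, leftVacuum_smul_vacuum,
        vev_creator_mul _ _ (dagger_mem_creators hx)]
      rfl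
    | smul a x _ hx =>
      refine LinearMap.ext fun v => ?_
      rw [daggerForm_apply, smul_eq_mul, dagger_mul, mul_smul, ← daggerForm_apply, hx]
      rfl)

theorem fockForm_smul_vacuum (a : Fermions) (y : Fock) :
    fockForm (a • vacuum) y = leftVacuum (dagger a • y) := by
  rw [← mk_eq_smul_vacuum]
  rfl

theorem fockForm_smul (a : Fermions) (x y : Fock) :
    fockForm (a • x) y = fockForm x (dagger a • y) := by
  obtain ⟨b, rfl⟩ := Submodule.Quotient.mk_surjective _ x
  rw [mk_eq_smul_vacuum, smul_smul, fockForm_smul_vacuum, fockForm_smul_vacuum, dagger_mul,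
    mul_smul]

theorem fockForm_psi (m : ℤ) (x y : Fock) :
    fockForm (psi m • x) y = fockForm x (psiStar m • y) := by
  rw [fockForm_smul, dagger_psi]

theorem fockForm_psiStar (m : ℤ) (x y : Fock) :
    fockForm (psiStar m • x) y = fockForm x (psi m • y) := by
  rw [fockForm_smul, dagger_psiStar]

/-! ## Charged vacua -/

theorem eq_zero_of_eq_neg {x : Fock} (h : x = -x) : x = 0 := by
  have h2 : (2 : ℂ) • x = 0 := by
    rw [two_smul]
    nth_rewrite 2 [h]
    exact add_neg_cancel x
  exact (smul_eq_zero.mp h2).resolve_left two_ne_zero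

theorem psi_smul_psi (m n : ℤ) (x : Fock) : psi m • psi n • x = -(psi n • psi m • x) := by
  rw [eq_neg_iff_add_eq_zero, smul_smul, smul_smul, ← add_smul, psi_mul_psi, zero_smul]

theorem psi_smul_psi_self (m : ℤ) (x : Fock) : psi m • psi m • x = 0 :=
  eq_zero_of_eq_neg (psi_smul_psi m m x)

theorem psiStar_smul_psiStar (m n : ℤ) (x : Fock) :
    psiStar m • psiStar n • x = -(psiStar n • psiStar m • x) := by
  rw [eq_neg_iff_add_eq_zero, smul_smul, smul_smul, ← add_smul, psiStar_mul_psiStar, zero_smul]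

theorem psiStar_smul_psi (m n : ℤ) (x : Fock) :
    psiStar n • psi m • x = (if m = n then x else 0) - psi m • psiStar n • x := by
  rw [eq_sub_iff_add_eq, add_comm, smul_smul, smul_smul, ← add_smul, psi_mul_psiStar]
  split_ifs <;> simp

theorem psi_smul_psiStar (m n : ℤ) (x : Fock) :
    psi m • psiStar n • x = (if m = n then x else 0) - psiStar n • psi m • x := by
  rw [psiStar_smul_psi, sub_sub_cancel]

/-- The charged vacuum `|c⟩ = Ψ_c |0⟩`. -/
def vac (c : ℤ) : Fock := bigPsi c • vacuum

theorem bigPsi_ofNat_succ (n : ℕ) : bigPsi ((n : ℤ) + 1) = psi n * bigPsi n := by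
  change bigPsi (Int.ofNat (n + 1)) = psi n * bigPsi (Int.ofNat n)
  rw [bigPsi, bigPsi, List.range_succ]
  simp

theorem bigPsi_neg_succ (n : ℕ) : bigPsi (-(n : ℤ) - 1) = psiStar (-(n : ℤ) - 1) * bigPsi (-n) := by
  have h : (-(n : ℤ) - 1) = Int.negSucc n := by rw [Int.negSucc_eq]; ring
  conv_lhs => rw [h]
  rcases n with _ | n
  · simp [bigPsi]
  · have h' : (-((n + 1 : ℕ) : ℤ)) = Int.negSucc n := rfl
    rw [h', bigPsi, bigPsi, List.range_succ, ← h']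
    simp

theorem dagger_bigPsi (n : ℤ) : dagger (bigPsi n) = bigPsiStar n := by
  have h : ∀ (f g : ℕ → Fermions) (_ : ∀ i, dagger (f i) = g i) (L : List ℕ),
      dagger ((L.reverse.map f).prod) = (L.map g).prod := by
    intro f g hfg L
    induction L with
    | nil => exact dagger_one
    | cons a L ih =>
      rw [List.reverse_cons, List.map_append, List.prod_append, dagger_mul, ih]
      simp [hfg]
  rcases n with n | n
  · exact h _ _ (fun i => dagger_psi i) _
  · exact h _ _ (fun i => dagger_psiStar _) _

theorem expectation_eq (n : ℤ) (X : Module.End ℂ Fock) :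
    expectation n X = fockForm (vac n) (X (vac n)) := by
  rw [vac, fockForm_smul_vacuum, dagger_bigPsi]
  rfl

/-- In `|c⟩` exactly the levels below `c` are filled. Starting from the vacuum, each step up fills
one more level and each step down empties one; every other fermion anticommutes with the one added.
-/
theorem smul_vac_eq_zero (c : ℤ) :
    (∀ m, m < c → psi m • vac c = 0) ∧ ∀ m, c ≤ m → psiStar m • vac c = 0 := by
  induction c using Int.induction_on with
  | zero =>
    have h : vac 0 = vacuum := by
      change ((List.range 0).reverse.map _).prod • vacuum = vacuum
      simp
    rw [h]
    exact ⟨fun m hm => annihilator_smul_vacuum _ ⟨m, Or.inl ⟨hm, rfl⟩⟩,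
      fun m hm => annihilator_smul_vacuum _ ⟨m, Or.inr ⟨hm, rfl⟩⟩⟩
  | succ n ih =>
    have h : vac ((n : ℤ) + 1) = psi n • vac n := by
      rw [vac, bigPsi_ofNat_succ, mul_smul, vac]
    rw [h]
    refine ⟨fun m hm => ?_, fun m hm => ?_⟩
    · rcases (Int.lt_add_one_iff.mp hm).eq_or_lt with rfl | hlt
      · exact psi_smul_psi_self _ _
      · rw [psi_smul_psi, ih.1 m hlt, smul_zero, neg_zero]
    · rw [psiStar_smul_psi, if_neg (by omega), ih.2 m (by omega), smul_zero, sub_zero]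
  | pred n ih =>
    have h : vac (-(n : ℤ) - 1) = psiStar (-(n : ℤ) - 1) • vac (-n) := by
      rw [vac, bigPsi_neg_succ, mul_smul, vac]
    rw [h]
    refine ⟨fun m hm => ?_, fun m hm => ?_⟩
    · rw [psi_smul_psiStar, if_neg (by omega), ih.1 m (by omega), smul_zero, sub_zero]
    · rcases hm.eq_or_lt with rfl | hlt
      · exact eq_zero_of_eq_neg (psiStar_smul_psiStar _ _ _)
      · rw [psiStar_smul_psiStar, ih.2 m (by omega), smul_zero, neg_zero]

theorem psi_smul_vac_of_lt {m c : ℤ} (h : m < c) : psi m • vac c = 0 := (smul_vac_eq_zero c).1 m h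

theorem psiStar_smul_vac_of_le {m c : ℤ} (h : c ≤ m) : psiStar m • vac c = 0 :=
  (smul_vac_eq_zero c).2 m h

/-- For `c ≥ 0` this is the definition of `Ψ_{c+1}`. For `c < 0` it is `|c⟩` that is obtained from
`|c + 1⟩`, by `ψ*_c`, and `ψ_c ψ*_c = 1 - ψ*_c ψ_c` undoes it. -/
theorem psi_smul_vac_self (c : ℤ) : psi c • vac c = vac (c + 1) := by
  rcases le_or_gt 0 c with h | h
  · obtain ⟨n, rfl⟩ := Int.eq_ofNat_of_zero_le h
    rw [vac, vac, bigPsi_ofNat_succ, mul_smul]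
  · obtain ⟨n, hn⟩ := Int.eq_ofNat_of_zero_le (show 0 ≤ -(c + 1) by omega)
    obtain rfl : c = -(n : ℤ) - 1 := by omega
    have h1 : vac (-(n : ℤ) - 1) = psiStar (-(n : ℤ) - 1) • vac (-n) := by
      rw [vac, bigPsi_neg_succ, mul_smul, vac]
    rw [h1, psi_smul_psiStar, if_pos rfl, psi_smul_vac_of_lt (by omega), smul_zero, sub_zero,
      sub_add_cancel]

/-! ## Bilinear operators -/

theorem actsFinitely_shift (f : ℤ → ℂ) {k : ℤ} (hk : k ≠ 0) :
    ActsFinitely fun j => f j • (psi j * psiStar (j + k)) := fun v =>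
  (actsFinitely_H k hk v).subset fun j hj hj' => hj (by
    have hj' : (psi j * psiStar (j + k)) • v = 0 := hj'
    simp only [smul_assoc, hj', smul_zero])

/-- The operator `∑ j, f(j) ψ_j ψ*_{j+k}` on Fock space, `k ≠ 0`. -/
def shiftOp (f : ℤ → ℂ) {k : ℤ} (hk : k ≠ 0) : Module.End ℂ Fock :=
  sumOp (fun j => f j • (psi j * psiStar (j + k))) (actsFinitely_shift f hk)

theorem finite_support_shiftOp (f : ℤ → ℂ) {k : ℤ} (hk : k ≠ 0) (v : Fock) :
    (Function.support fun j => f j • psi j • psiStar (j + k) • v).Finite := by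
  simpa only [smul_assoc, mul_smul] using actsFinitely_shift f hk v

theorem shiftOp_apply (f : ℤ → ℂ) {k : ℤ} (hk : k ≠ 0) (v : Fock) :
    shiftOp f hk v = ∑ᶠ j, f j • psi j • psiStar (j + k) • v := by
  change ∑ᶠ j, (f j • (psi j * psiStar (j + k))) • v = _
  simp only [smul_assoc, mul_smul]

theorem opH_eq (k : ℕ+) {k' : ℤ} (hk : k' ≠ 0) (h : k' = (k : ℕ)) :
    opH k = shiftOp (fun _ => 1) hk := by
  subst h
  refine LinearMap.ext fun v => ?_
  rw [shiftOp_apply]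
  change ∑ᶠ j, (psi j * psiStar (j + (k : ℤ))) • v = _
  simp only [mul_smul, one_smul]

/-- Reordering `ψ*_{j-k} ψ_j`, whose indices differ, absorbs the sign of `-A_k`. -/
theorem neg_opA_eq (r : ℤ → ℂ) (k : ℕ+) {k' : ℤ} (hk : k' ≠ 0) (h : k' = -(k : ℕ)) :
    -opA r k = shiftOp (fun j => ∏ i ∈ Finset.range k, r (j - i)) hk := by
  subst h
  refine LinearMap.ext fun v => ?_
  rw [shiftOp_apply]
  change -∑ᶠ j : ℤ, ((∏ i ∈ Finset.range k, r (j - i)) • (psiStar (j - k) * psi j)) • v = _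
  rw [← finsum_neg_distrib]
  refine finsum_congr fun j => ?_
  have hj : psiStar (j - k) * psi j = -(psi j * psiStar (j + -(k : ℕ))) := by
    have := k.pos
    rw [← sub_eq_add_neg, psi_mul_psiStar_of_ne (by omega), neg_neg]
  rw [hj, smul_neg, neg_smul, neg_neg, smul_assoc, mul_smul]

theorem smul_finsum_of_finite (a : Fermions) (g : ℤ → Fock) (h : (Function.support g).Finite) :
    a • ∑ᶠ j, g j = ∑ᶠ j, a • g j :=
  (Algebra.lsmul ℂ ℂ Fock a).toAddMonoidHom.map_finsum h

theorem finite_support_const_smul (a : Fermions) {g : ℤ → Fock}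
    (h : (Function.support g).Finite) : (Function.support fun j => a • g j).Finite :=
  h.subset fun j hj hj' => hj (by
    have hj' : g j = 0 := hj'
    simp only [hj', smul_zero])

theorem finite_support_ite (m : ℤ) (x : ℤ → Fock) :
    (Function.support fun j => if j = m then x j else 0).Finite :=
  (Set.finite_singleton m).subset fun j hj => by
    by_contra h
    exact hj (if_neg h)

/-- The commutator with `ψ_m` comes from the single term `j + k = m`. -/
theorem shiftOp_psi (f : ℤ → ℂ) {k : ℤ} (hk : k ≠ 0) (m : ℤ) (v : Fock) :
    shiftOp f hk (psi m • v) = f (m - k) • psi (m - k) • v + psi m • shiftOp f hk v := by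
  have h := finite_support_shiftOp f hk v
  have h1 : ∀ j, f j • psi j • psiStar (j + k) • psi m • v =
      (if j = m - k then f j • psi j • v else 0) + psi m • f j • psi j • psiStar (j + k) • v := by
    intro j
    rw [psiStar_smul_psi, smul_sub, psi_smul_psi j, sub_neg_eq_add, smul_add,
      smul_comm (f j) (psi m)]
    congr 1
    by_cases hj : j = m - k
    · rw [if_pos hj, if_pos (by omega)]
    · rw [if_neg hj, if_neg (by omega), smul_zero, smul_zero]
  rw [shiftOp_apply, shiftOp_apply, smul_finsum_of_finite _ _ h, finsum_congr h1,
    finsum_add_distrib (finite_support_ite _ _) (finite_support_const_smul _ h),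
    finsum_eq_single _ (m - k) (fun j hj => if_neg hj), if_pos rfl]

theorem shiftOp_psiStar (f : ℤ → ℂ) {k : ℤ} (hk : k ≠ 0) (m : ℤ) (v : Fock) :
    shiftOp f hk (psiStar m • v) =
      -(f m • psiStar (m + k) • v) + psiStar m • shiftOp f hk v := by
  have h := finite_support_shiftOp f hk v
  have h1 : ∀ j, f j • psi j • psiStar (j + k) • psiStar m • v =
      (if j = m then -(f j • psiStar (j + k) • v) else 0) +
        psiStar m • f j • psi j • psiStar (j + k) • v := by
    intro j
    rw [psiStar_smul_psiStar, smul_neg, psi_smul_psiStar, neg_sub, smul_sub, sub_eq_add_neg,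
      add_comm, smul_comm (f j) (psiStar m)]
    congr 1
    split_ifs <;> simp
  rw [shiftOp_apply, shiftOp_apply, smul_finsum_of_finite _ _ h, finsum_congr h1,
    finsum_add_distrib (finite_support_ite _ _) (finite_support_const_smul _ h),
    finsum_eq_single _ m (fun j hj => if_neg hj), if_pos rfl]

/-- For `k > 0` each term moves a fermion down: either level `j + k` is empty, or it is filled and
then so is the target `j`. -/
theorem shiftOp_vac (f : ℤ → ℂ) {k : ℤ} (hk : k ≠ 0) (hk' : 0 < k) (c : ℤ) :
    shiftOp f hk (vac c) = 0 := by
  rw [shiftOp_apply]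
  refine finsum_eq_zero_of_forall_eq_zero fun j => ?_
  rcases le_or_gt c (j + k) with h | h
  · rw [psiStar_smul_vac_of_le h, smul_zero, smul_zero]
  · rw [psi_smul_psiStar, if_neg (by omega), psi_smul_vac_of_lt (by omega), smul_zero, sub_zero,
      smul_zero]

/-- The adjoint of `ψ_j ψ*_{j+k}` is `ψ_{j+k} ψ*_j`; reindexing by `j + k` turns the sum into a
shift by `-k`. -/
theorem fockForm_shiftOp (f g : ℤ → ℂ) {k l : ℤ} (hk : k ≠ 0) (hl : l ≠ 0) (h : l = -k)
    (hfg : ∀ j, g (j + k) = f j) (x y : Fock) :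
    fockForm (shiftOp f hk x) y = fockForm x (shiftOp g hl y) := by
  subst h
  have e1 : fockForm (shiftOp f hk x) y =
      ∑ᶠ j, fockForm (f j • psi j • psiStar (j + k) • x) y := by
    rw [shiftOp_apply]
    exact (fockForm.flip y).toAddMonoidHom.map_finsum (finite_support_shiftOp f hk x)
  have e2 : fockForm x (shiftOp g hl y) =
      ∑ᶠ j, fockForm x (g j • psi j • psiStar (j + -k) • y) := by
    rw [shiftOp_apply]
    exact (fockForm x).toAddMonoidHom.map_finsum (finite_support_shiftOp g hl y)
  rw [e1, e2, ← finsum_comp_equiv (Equiv.addRight (-k))]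
  refine finsum_congr fun j => ?_
  have hg : g j = f (j + -k) := by rw [← hfg, neg_add_cancel_right]
  simp only [Equiv.coe_addRight]
  rw [hg, map_smul, LinearMap.smul_apply, fockForm_psi, fockForm_psiStar,
    (fockForm x).map_smul, neg_add_cancel_right]

/-! ## Wedge vectors -/

/-- The vector `ψ_{a_1} ⋯ ψ_{a_l} |c⟩`. -/
def listVec (L : List ℤ) (c : ℤ) : Fock := (L.map psi).prod • vac c

theorem listVec_nil (c : ℤ) : listVec [] c = vac c := by simp [listVec]

theorem listVec_cons (m : ℤ) (L : List ℤ) (c : ℤ) :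
    listVec (m :: L) c = psi m • listVec L c := by
  rw [listVec, List.map_cons, List.prod_cons, mul_smul, listVec]

/-- Lets a wedge vector be written with more factors over a deeper vacuum, so that two of them can
be brought to a common length. -/
theorem listVec_concat (L : List ℤ) (c : ℤ) :
    listVec (L ++ [c]) c = listVec L (c + 1) := by
  induction L with
  | nil => rw [List.nil_append, listVec_cons, listVec_nil, listVec_nil, psi_smul_vac_self]
  | cons m L ih => rw [List.cons_append, listVec_cons, listVec_cons, ih]

theorem psi_smul_listVec_eq_zero {m : ℤ} {L : List ℤ} {c : ℤ} (h : m ∈ L ∨ m < c) :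
    psi m • listVec L c = 0 := by
  induction L with
  | nil =>
    rw [listVec_nil]
    exact psi_smul_vac_of_lt (h.resolve_left (by simp))
  | cons a L ih =>
    rw [listVec_cons]
    by_cases hma : m = a
    · rw [hma, psi_smul_psi_self]
    · rw [psi_smul_psi, ih, smul_zero, neg_zero]
      exact h.imp_left fun h => (List.mem_cons.mp h).resolve_left hma

/-- Pauli exclusion: a level is occupied twice, either within the list or by the list and the sea
below `c`. -/
theorem listVec_eq_zero {L : List ℤ} {c : ℤ} (h : ¬ L.Nodup ∨ ∃ m ∈ L, m < c) :
    listVec L c = 0 := by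
  induction L with
  | nil => simp at h
  | cons a L ih =>
    rw [listVec_cons]
    by_cases h' : ¬ L.Nodup ∨ ∃ m ∈ L, m < c
    · rw [ih h', smul_zero]
    · refine psi_smul_listVec_eq_zero ?_
      rw [List.nodup_cons, List.exists_mem_cons_iff] at h
      rcases h with h | h | h
      · exact Or.inl (by_contra fun ha => h ⟨ha, by_contra fun hn => h' (Or.inl hn)⟩)
      · exact Or.inr h
      · exact absurd (Or.inr h) h'

/-- The two vectors differ by a sign, which is left undetermined because only spans are needed. -/
theorem listVec_perm {L L' : List ℤ} (h : L.Perm L') (c : ℤ) :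
    listVec L c ∈ Submodule.span ℂ {listVec L' c} := by
  simp only [Submodule.mem_span_singleton]
  induction h with
  | nil => exact ⟨1, one_smul _ _⟩
  | cons x _ ih =>
    obtain ⟨s, hs⟩ := ih
    exact ⟨s, by rw [listVec_cons, listVec_cons, ← hs, smul_comm]⟩
  | swap x y L =>
    refine ⟨-1, ?_⟩
    rw [listVec_cons, listVec_cons, listVec_cons, listVec_cons, psi_smul_psi y x, neg_smul,
      one_smul]
  | trans _ _ ih1 ih2 =>
    obtain ⟨s, hs⟩ := ih1
    obtain ⟨t, ht⟩ := ih2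
    exact ⟨s * t, by rw [mul_smul, ht, hs]⟩

/-- Moving `ψ*_m` to the right past the `ψ_{a i}` produces alternating signs, and at the end it
kills `|c⟩` because `c ≤ m`. The signs are those of a Laplace expansion. -/
theorem psiStar_smul_listVec {N : ℕ} (a : Fin (N + 1) → ℤ) {m c : ℤ} (hm : c ≤ m) :
    psiStar m • listVec (List.ofFn a) c = ∑ i : Fin (N + 1),
      ((-1 : ℂ) ^ (i : ℕ) * if a i = m then 1 else 0) •
        listVec (List.ofFn (a ∘ i.succAbove)) c := by
  induction N with
  | zero =>
    rw [List.ofFn_succ, listVec_cons, psiStar_smul_psi]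
    simp [listVec_nil, psiStar_smul_vac_of_le hm]
  | succ N ih =>
    rw [List.ofFn_succ, listVec_cons, psiStar_smul_psi, ih (fun i => a i.succ),
      Fin.sum_univ_succ (n := N + 1)]
    rw [sub_eq_add_neg, Finset.smul_sum, ← Finset.sum_neg_distrib]
    congr 1
    · simp [Function.comp_def]
    · refine Finset.sum_congr rfl fun i _ => ?_
      have h : List.ofFn (a ∘ i.succ.succAbove) =
          a 0 :: List.ofFn ((fun i => a i.succ) ∘ i.succAbove) := by
        rw [List.ofFn_succ]
        simp [Function.comp_def]
      rw [h, listVec_cons, Fin.val_succ, pow_succ, smul_comm (psi (a 0)), ← neg_smul]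
      congr 1
      ring

theorem fockForm_vac_self (c : ℤ) : fockForm (vac c) (vac c) = 1 := by
  have step : ∀ c, fockForm (vac (c + 1)) (vac (c + 1)) = fockForm (vac c) (vac c) := by
    intro c
    rw [← psi_smul_vac_self, fockForm_psi, psiStar_smul_psi, if_pos rfl,
      psiStar_smul_vac_of_le le_rfl, smul_zero, sub_zero]
  have h0 : vac 0 = vacuum := by
    change ((List.range 0).reverse.map _).prod • vacuum = vacuum
    simp
  induction c using Int.induction_on with
  | zero =>
    rw [h0, ← one_smul Fermions vacuum, fockForm_smul_vacuum, dagger_one, one_smul,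
      leftVacuum_smul_vacuum, vev_one]
  | succ n ih => rw [step, ih]
  | pred n ih => rw [← step, sub_add_cancel, ih]

/-- Moving `ψ_{b 0}` across the form and contracting it is the Laplace expansion along the first
column. -/
theorem fockForm_listVec {N : ℕ} (a b : Fin N → ℤ) {c : ℤ} (hb : ∀ j, c ≤ b j) :
    fockForm (listVec (List.ofFn b) c) (listVec (List.ofFn a) c) =
      Matrix.det (Matrix.of fun i j => if a i = b j then (1 : ℂ) else 0) := by
  induction N with
  | zero => simp [listVec_nil, fockForm_vac_self]
  | succ N ih =>
    rw [List.ofFn_succ (f := b), listVec_cons, fockForm_psi, psiStar_smul_listVec a (hb 0),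
      map_sum, Matrix.det_succ_column_zero]
    refine Finset.sum_congr rfl fun i _ => ?_
    rw [map_smul, ih _ _ (fun j => hb j.succ), smul_eq_mul]
    rfl

/-- The operator acts on products of `ψ`'s as a derivation and kills `|c⟩` since `k > 0`. -/
theorem shiftOp_listVec (f : ℤ → ℂ) {k : ℤ} (hk : k ≠ 0) (hk' : 0 < k) {N : ℕ}
    (a : Fin N → ℤ) (c : ℤ) : shiftOp f hk (listVec (List.ofFn a) c) =
      ∑ i, f (a i - k) • listVec (List.ofFn (Function.update a i (a i - k))) c := by
  induction N with
  | zero => simp [listVec_nil, shiftOp_vac f hk hk']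
  | succ N ih =>
    rw [List.ofFn_succ, listVec_cons, shiftOp_psi, ih, Fin.sum_univ_succ, Finset.smul_sum]
    congr 1
    · rw [List.ofFn_succ, listVec_cons, Function.update_self]
      have h : (fun i : Fin N => Function.update a 0 (a 0 - k) i.succ) = fun i => a i.succ := by
        ext i
        rw [Function.update_of_ne (Fin.succ_ne_zero i)]
      rw [h]
    · refine Finset.sum_congr rfl fun i _ => ?_
      have h : (fun j : Fin N => Function.update a i.succ (a i.succ - k) j.succ) =
          Function.update (fun j => a j.succ) i (a i.succ - k) :=
        Function.update_comp_eq_of_injective a (Fin.succ_injective N) i _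
      rw [List.ofFn_succ (f := Function.update a i.succ _), listVec_cons, h,
        Function.update_of_ne (Fin.succ_ne_zero i).symm, smul_comm]

/-! ## The charge decomposition -/

/-- The span of the vectors `ψ_{a_1} ⋯ ψ_{a_l} |c⟩` with `l + c = q`. -/
def chargeSpan (q : ℤ) : Submodule ℂ Fock :=
  Submodule.span ℂ {x | ∃ (L : List ℤ) (c : ℤ), (L.length : ℤ) + c = q ∧ x = listVec L c}

theorem listVec_mem_chargeSpan (L : List ℤ) (c : ℤ) :
    listVec L c ∈ chargeSpan (L.length + c) :=
  Submodule.subset_span ⟨L, c, rfl, rfl⟩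

theorem vac_mem_chargeSpan (c : ℤ) : vac c ∈ chargeSpan c :=
  Submodule.subset_span ⟨[], c, by simp, (listVec_nil c).symm⟩

theorem smul_mem_of_listVec {q : ℤ} (S : Submodule ℂ Fock) (a : Fermions)
    (h : ∀ L c, (L.length : ℤ) + c = q → a • listVec L c ∈ S) {x : Fock}
    (hx : x ∈ chargeSpan q) : a • x ∈ S := by
  have : chargeSpan q ≤ S.comap (Algebra.lsmul ℂ ℂ Fock a) := by
    rw [chargeSpan, Submodule.span_le]
    rintro _ ⟨L, c, hL, rfl⟩
    exact h L c hL
  exact this hx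

theorem psi_smul_mem_chargeSpan (m : ℤ) {q : ℤ} {x : Fock} (hx : x ∈ chargeSpan q) :
    psi m • x ∈ chargeSpan (q + 1) := by
  refine smul_mem_of_listVec _ _ (fun L c hL => ?_) hx
  rw [← listVec_cons]
  exact Submodule.subset_span ⟨m :: L, c, by rw [List.length_cons]; push_cast; omega, rfl⟩

/-- For `m < c`, write `|c⟩ = ψ_{c-1} |c - 1⟩`, move `ψ*_m` past `ψ_{c-1}`, and descend until the
vacuum is at or below `m`. -/
theorem psiStar_smul_vac_mem_chargeSpan (m c : ℤ) :
    psiStar m • vac c ∈ chargeSpan (c - 1) := by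
  rcases le_or_gt c m with h | h
  · rw [psiStar_smul_vac_of_le h]
    exact zero_mem _
  · obtain ⟨k, hk⟩ := Int.le.dest h.le
    induction k generalizing c with
    | zero => omega
    | succ k ih =>
      have h1 : psi (c - 1) • vac (c - 1) = vac c := by
        rw [psi_smul_vac_self, sub_add_cancel]
      rw [← h1, psiStar_smul_psi]
      refine sub_mem ?_ ?_
      · split_ifs
        · exact vac_mem_chargeSpan _
        · exact zero_mem _
      · have h2 : psiStar m • vac (c - 1) ∈ chargeSpan (c - 1 - 1) := by
          rcases le_or_gt (c - 1) m with h' | h'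
          · rw [psiStar_smul_vac_of_le h']
            exact zero_mem _
          · exact ih (c - 1) h' (by push_cast at hk; omega)
        simpa using psi_smul_mem_chargeSpan (c - 1) h2

theorem psiStar_smul_mem_chargeSpan (m : ℤ) {q : ℤ} {x : Fock} (hx : x ∈ chargeSpan q) :
    psiStar m • x ∈ chargeSpan (q - 1) := by
  refine smul_mem_of_listVec _ _ (fun L c hL => ?_) hx
  clear hx x
  induction L generalizing q with
  | nil =>
    obtain rfl : c = q := by simpa using hL
    rw [listVec_nil]
    exact psiStar_smul_vac_mem_chargeSpan m c
  | cons a L ih =>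
    rw [List.length_cons] at hL
    push_cast at hL
    rw [listVec_cons, psiStar_smul_psi]
    refine sub_mem ?_ ?_
    · split_ifs
      · have := listVec_mem_chargeSpan L c
        rwa [show (L.length : ℤ) + c = q - 1 by omega] at this
      · exact zero_mem _
    · have := psi_smul_mem_chargeSpan a (ih (q := q - 1) (by omega))
      simpa using this

theorem shiftOp_mem_chargeSpan (f : ℤ → ℂ) {k : ℤ} (hk : k ≠ 0) {q : ℤ} {x : Fock}
    (hx : x ∈ chargeSpan q) : shiftOp f hk x ∈ chargeSpan q := by
  rw [shiftOp_apply]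
  refine finsum_induction (p := fun y => y ∈ chargeSpan q) (zero_mem _)
    (fun _ _ => add_mem) fun j => ?_
  have := psi_smul_mem_chargeSpan j (psiStar_smul_mem_chargeSpan (j + k) hx)
  rw [sub_add_cancel] at this
  exact Submodule.smul_mem _ _ this

/-! ## The Heisenberg relation -/

/-- The central term comes from the sea: commuting `H_k` past the pairs `ψ_j ψ*_{j-l}` gives
differences of one sequence `g` at arguments `k` apart. The two windows cancel unless `k = l`, when
`g` is `|c⟩` below `c` and zero from `c` on, leaving `k` copies. -/
theorem shiftOp_shiftOp_vac {k l : ℤ} (hk : k ≠ 0) (hl : -l ≠ 0) (hk' : 0 < k) (hl' : 0 < l) (c : ℤ) :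
    shiftOp (fun _ => 1) hk (shiftOp (fun _ => 1) hl (vac c)) =
      (if k = l then (k : ℂ) else 0) • vac c := by
  let g : ℤ → Fock := fun i => psi i • psiStar (i + (k - l)) • vac c
  -- Only fermions taken from a filled level `j - l < c` to an empty level `j ≥ c` survive.
  have h1 : shiftOp (fun _ => 1) hl (vac c) =
      ∑ j ∈ Finset.Ico c (c + l), psi j • psiStar (j + -l) • vac c := by
    rw [shiftOp_apply]
    simp only [one_smul]
    refine finsum_eq_sum_of_support_subset _ fun j hj => ?_
    rw [Finset.coe_Ico, Set.mem_Ico]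
    by_contra hc
    apply hj
    rcases le_or_gt c (j + -l) with h | h
    · simp only [psiStar_smul_vac_of_le h, smul_zero]
    · simp only [psi_smul_psiStar]
      rw [if_neg (by omega), psi_smul_vac_of_lt (by omega), smul_zero, sub_zero]
  have h2 : ∀ j, shiftOp (fun _ => 1) hk (psi j • psiStar (j + -l) • vac c) =
      g (j - k) - g j := by
    intro j
    rw [shiftOp_psi, shiftOp_psiStar, shiftOp_vac _ hk hk', smul_zero, add_zero, one_smul,
      one_smul, smul_neg, ← sub_eq_add_neg]
    simp only [g]
    congr 4 <;> ring_nf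
  have h3 : ∑ j ∈ Finset.Ico c (c + l), g (j - k) = ∑ i ∈ Finset.Ico (c - k) (c + l - k), g i := by
    refine Finset.sum_nbij' (fun j => j - k) (fun j => j + k) ?_ ?_ ?_ ?_ ?_
    · intro j hj; rw [Finset.mem_Ico] at hj ⊢; omega
    · intro j hj; rw [Finset.mem_Ico] at hj ⊢; omega
    · intro j _; ring
    · intro j _; ring
    · intro j _; rfl
  have h4 : ∀ i, c ≤ i + (k - l) → g i = 0 := by
    intro i hi
    simp only [g]
    rw [psiStar_smul_vac_of_le hi, smul_zero]
  rw [h1, map_sum, Finset.sum_congr rfl fun j _ => h2 j, Finset.sum_sub_distrib, h3]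
  by_cases hkl : k = l
  · have h5 : ∀ i, i < c → g i = vac c := by
      intro i hi
      simp only [g]
      rw [psi_smul_psiStar, if_pos (by omega), psi_smul_vac_of_lt hi, smul_zero, sub_zero]
    rw [if_pos hkl, Finset.sum_eq_zero (s := Finset.Ico c (c + l)), sub_zero,
      Finset.sum_congr (g := fun _ => vac c) rfl, Finset.sum_const, Int.card_Ico]
    · have h6 : ((c + l - k - (c - k)).toNat : ℤ) = k := by omega
      have h7 : ((c + l - k - (c - k)).toNat : ℂ) = (k : ℂ) := by exact_mod_cast h6
      rw [← h7, Nat.cast_smul_eq_nsmul]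
    · intro i hi
      rw [Finset.mem_Ico] at hi
      exact h5 i (by omega)
    · intro i hi
      rw [Finset.mem_Ico] at hi
      exact h4 i (by omega)
  · have h5 : ∀ i, i < c → g i = 0 := by
      intro i hi
      simp only [g]
      rw [psi_smul_psiStar, if_neg (by omega), psi_smul_vac_of_lt hi, smul_zero, sub_zero]
    rw [if_neg hkl, zero_smul, sub_eq_zero]
    -- For `k ≠ l`, `g` vanishes outside `[c, c + l - k)`, which both windows contain.
    have h6 : ∀ s : Finset ℤ, Finset.Ico c (c + l - k) ⊆ s →
        ∑ i ∈ s, g i = ∑ i ∈ Finset.Ico c (c + l - k), g i := by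
      intro s hs
      symm
      refine Finset.sum_subset hs fun i _ hi => ?_
      rw [Finset.mem_Ico, not_and_or] at hi
      rcases hi with hi | hi
      · exact h5 i (by omega)
      · exact h4 i (by omega)
    rw [h6 (Finset.Ico (c - k) _) (Finset.Ico_subset_Ico (by omega) le_rfl),
      h6 (Finset.Ico c (c + l)) (Finset.Ico_subset_Ico le_rfl (by omega))]

/-- The two shifts act on the index of `ψ_m` by commuting translations, so their commutator commutes
with every `ψ_m` and is determined by its value on the charged vacua. -/
theorem shiftOp_commute {k l : ℤ} (hk : k ≠ 0) (hl : -l ≠ 0) (hk' : 0 < k) (hl' : 0 < l) {q : ℤ}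
    {x : Fock} (hx : x ∈ chargeSpan q) :
    shiftOp (fun _ => 1) hk (shiftOp (fun _ => 1) hl x) =
      shiftOp (fun _ => 1) hl (shiftOp (fun _ => 1) hk x) +
        (if k = l then (k : ℂ) else 0) • x := by
  have key : chargeSpan q ≤ LinearMap.eqLocus
      (shiftOp (fun _ => 1) hk * shiftOp (fun _ => 1) hl)
      (shiftOp (fun _ => 1) hl * shiftOp (fun _ => 1) hk + (if k = l then (k : ℂ) else 0) • 1) := by
    rw [chargeSpan, Submodule.span_le]
    rintro _ ⟨L, c, -, rfl⟩
    rw [SetLike.mem_coe, LinearMap.mem_eqLocus]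
    simp only [Module.End.mul_apply, LinearMap.add_apply, LinearMap.smul_apply,
      Module.End.one_apply]
    induction L with
    | nil =>
      rw [listVec_nil, shiftOp_shiftOp_vac hk hl hk' hl', shiftOp_vac _ hk hk', map_zero, zero_add]
    | cons m L ih =>
      rw [listVec_cons]
      simp only [shiftOp_psi, map_add, one_smul, ih, smul_add]
      rw [smul_comm (psi m)]
      have : m - -l - k = m - k - -l := by ring
      rw [this]
      abel
  exact key hx

/-! ## Content products of sequences -/

/-- The number of `a_i` which are at least `j`, relative to the sequence `n - 1, n - 2, …, n - N`. -/
def excess (n : ℤ) {N : ℕ} (a : Fin N → ℤ) (j : ℤ) : ℕ :=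
  (Finset.univ.filter fun i => j ≤ a i).card -
    (Finset.univ.filter fun i : Fin N => j ≤ n - 1 - (i : ℤ)).card

/-- The product of the `r(j)` over the levels crossed in passing from `n - 1, n - 2, …, n - N`
to `a`, where `a` is bounded by `M`. -/
def levelProd (r : ℤ → ℂ) (n : ℤ) {N : ℕ} (a : Fin N → ℤ) (M : ℤ) : ℂ :=
  ∏ j ∈ Finset.Ico (n - N) M, r j ^ excess n a j

/-- Fewer distinct values fit into `[n - N, j)` than would be needed to violate this. It makes the
truncated subtraction in `excess` a true one. -/
theorem card_filter_le_of_injective (n : ℤ) {N : ℕ} (a : Fin N → ℤ) (ha : Function.Injective a)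
    (hc : ∀ i, n - N ≤ a i) {j : ℤ} (hj : n - N ≤ j) :
    (Finset.univ.filter fun i : Fin N => j ≤ n - 1 - (i : ℤ)).card ≤
      (Finset.univ.filter fun i => j ≤ a i).card := by
  have h1 : (Finset.univ.filter fun i : Fin N => j ≤ n - 1 - (i : ℤ)).card ≤
      (Finset.range (n - j).toNat).card := by
    refine Finset.card_le_card_of_injOn (fun i => (i : ℕ)) (fun i hi => ?_)
      Fin.val_injective.injOn
    have hi : j ≤ n - 1 - (i : ℤ) := by simpa using hi
    rw [Finset.coe_range, Set.mem_Iio]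
    change (i : ℕ) < _
    omega
  have h2 : (Finset.univ.filter fun i => ¬ j ≤ a i).card ≤ (Finset.Ico (n - N) j).card := by
    refine Finset.card_le_card_of_injOn a (fun i hi => ?_) ha.injOn
    have hi : a i < j := by simpa using hi
    rw [Finset.coe_Ico]
    exact ⟨hc i, hi⟩
  have h3 := Finset.card_filter_add_card_filter_not (s := (Finset.univ : Finset (Fin N)))
    (fun i => j ≤ a i)
  rw [Finset.card_range] at h1
  rw [Int.card_Ico] at h2
  rw [Finset.card_univ, Fintype.card_fin] at h3
  omega

theorem card_filter_update {N : ℕ} (a : Fin N → ℤ) (i : Fin N) {b : ℤ} (hb : b ≤ a i) (j : ℤ) :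
    (Finset.univ.filter fun l => j ≤ a l).card =
      (if b < j ∧ j ≤ a i then 1 else 0) +
        (Finset.univ.filter fun l => j ≤ Function.update a i b l).card := by
  rw [Finset.card_filter, Finset.card_filter,
    ← Finset.add_sum_erase _ _ (Finset.mem_univ i),
    ← Finset.add_sum_erase Finset.univ (fun l => if j ≤ Function.update a i b l then 1 else 0)
      (Finset.mem_univ i), ← add_assoc, Function.update_self]
  congr 1
  · split_ifs <;> omega
  · refine Finset.sum_congr rfl fun l hl => ?_
    rw [Function.update_of_ne (Finset.ne_of_mem_erase hl)]

theorem prod_ite_interval (r : ℤ → ℂ) {c M b e : ℤ} (hb : c ≤ b + 1) (he : e < M) :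
    ∏ j ∈ Finset.Ico c M, r j ^ (if b < j ∧ j ≤ e then 1 else 0) = ∏ j ∈ Finset.Ioc b e, r j := by
  have h : Finset.Ioc b e ⊆ Finset.Ico c M := by
    intro j hj
    rw [Finset.mem_Ioc] at hj
    rw [Finset.mem_Ico]
    omega
  rw [← Finset.prod_subset h]
  · refine Finset.prod_congr rfl fun j hj => ?_
    rw [if_pos (Finset.mem_Ioc.mp hj), pow_one]
  · intro j _ hj
    rw [Finset.mem_Ioc] at hj
    rw [if_neg hj, pow_zero]

theorem prod_Ioc_eq_prod_range (r : ℤ → ℂ) (e : ℤ) (k : ℕ) :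
    ∏ j ∈ Finset.Ioc (e - k) e, r j = ∏ l ∈ Finset.range k, r (e - l) := by
  symm
  refine Finset.prod_nbij' (fun l => e - l) (fun j => (e - j).toNat) ?_ ?_ ?_ ?_ ?_
  · intro l hl; rw [Finset.mem_range] at hl; rw [Finset.mem_Ioc]; omega
  · intro j hj; rw [Finset.mem_Ioc] at hj; rw [Finset.mem_range]; omega
  · intro l _; simp
  · intro j hj; rw [Finset.mem_Ioc] at hj; omega
  · intro l _; rfl

/-- Lowering `a i` by `k` reduces the excess by one at exactly the levels `a i - k + 1, …, a i`. The
hypotheses on the lowered sequence exclude truncation in `excess`. -/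
theorem levelProd_update (r : ℤ → ℂ) (n : ℤ) {N : ℕ} (a : Fin N → ℤ) {M : ℤ} (i : Fin N) (k : ℕ)
    (hM : a i < M) (hinj : Function.Injective (Function.update a i (a i - k)))
    (hc : ∀ l, n - N ≤ Function.update a i (a i - k) l) :
    levelProd r n a M = (∏ l ∈ Finset.range k, r (a i - l)) *
      levelProd r n (Function.update a i (a i - k)) M := by
  have hci := hc i
  rw [Function.update_self] at hci
  rw [← prod_Ioc_eq_prod_range, ← prod_ite_interval r (c := n - N) (by omega) hM, levelProd,
    levelProd, ← Finset.prod_mul_distrib]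
  refine Finset.prod_congr rfl fun j hj => ?_
  rw [Finset.mem_Ico] at hj
  rw [← pow_add, excess, excess, card_filter_update a i (show a i - (k : ℤ) ≤ a i by omega),
    Nat.add_sub_assoc (card_filter_le_of_injective n _ hinj hc hj.1)]

/-! ## Matrix elements of the exponential of the adjoint operators -/

/-- The operator adjoint to `-A_m`. -/
def opAdj (r : ℤ → ℂ) (m : ℕ+) : Module.End ℂ Fock :=
  shiftOp (fun j => ∏ l ∈ Finset.range m, r (j + (m : ℕ) - l)) (k := ((m : ℕ) : ℤ))
    (Int.natCast_ne_zero.mpr m.pos.ne')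

theorem fockForm_opA (r : ℤ → ℂ) (m : ℕ+) (x y : Fock) :
    fockForm ((-opA r m) x) y = fockForm x (opAdj r m y) := by
  rw [neg_opA_eq r m (neg_ne_zero.mpr (Int.natCast_ne_zero.mpr m.pos.ne')) rfl]
  refine fockForm_shiftOp _ _ _ _ (neg_neg _).symm (fun j => ?_) x y
  simp only [neg_add_cancel_right]

theorem opAdj_one (m : ℕ+) : opAdj (fun _ => 1) m = opH m := by
  rw [opH_eq m (Int.natCast_ne_zero.mpr m.pos.ne') rfl, opAdj]
  simp only [Finset.prod_const_one]

theorem vac_eq_listVec (n : ℤ) (N : ℕ) :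
    vac n = listVec (List.ofFn fun i : Fin N => n - 1 - (i : ℤ)) (n - N) := by
  induction N with
  | zero => simp [listVec_nil]
  | succ N ih =>
    rw [List.ofFn_succ', List.concat_eq_append]
    have h : n - 1 - ((Fin.last N : Fin (N + 1)) : ℤ) = n - (N + 1 : ℕ) := by simp; ring
    rw [h, listVec_concat, ih]
    congr 1
    push_cast
    ring

/-- Both sides are the determinant with entries `1` where `a i = n - 1 - j` and `0` elsewhere. -/
theorem fockForm_vac_listVec (n : ℤ) {N : ℕ} (a : Fin N → ℤ) :
    fockForm (vac n) (listVec (List.ofFn a) (n - N)) = MvPolynomial.coeff 0 (schurDet n a) := by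
  rw [vac_eq_listVec n N, fockForm_listVec, coeff_zero_schurDet]
  intro j
  have := j.isLt
  omega

theorem levelProd_mul_coeff_zero (r : ℤ → ℂ) (n : ℤ) {N : ℕ} (a : Fin N → ℤ) (M : ℤ) :
    levelProd r n a M * MvPolynomial.coeff 0 (schurDet n a) =
      MvPolynomial.coeff 0 (schurDet n a) := by
  by_cases h : MvPolynomial.coeff 0 (schurDet n a) = 0
  · rw [h, mul_zero]
  · suffices levelProd r n a M = 1 by rw [this, one_mul]
    -- A nonzero term makes `a` a rearrangement of `n - 1, …, n - N`, so every excess is zero.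
    rw [coeff_zero_schurDet, Matrix.det_apply] at h
    obtain ⟨σ, -, hσ⟩ := Finset.exists_ne_zero_of_sum_ne_zero h
    have h1 : ∀ i, a (σ i) = n - 1 - (i : ℤ) := by
      intro i
      by_contra hi
      apply hσ
      rw [Finset.prod_eq_zero (Finset.mem_univ i), smul_zero]
      simp [hi]
    refine Finset.prod_eq_one fun j _ => ?_
    have h2 : (Finset.univ.filter fun i => j ≤ a i).card =
        (Finset.univ.filter fun i : Fin N => j ≤ n - 1 - (i : ℤ)).card := by
      rw [Finset.card_filter, Finset.card_filter, ← Equiv.sum_comp σ]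
      simp only [h1]
    rw [excess, h2, Nat.sub_self, pow_zero]

/-- The relation between Fock space and `Λ` spanned by the pairs of a wedge vector and a multiple of
the corresponding determinant. -/
def wedgeRel (r : ℤ → ℂ) (n : ℤ) (N : ℕ) (M : ℤ) : Submodule ℂ (Fock × SymFun) :=
  Submodule.span ℂ {p | ∃ a : Fin N → ℤ, (∀ i, a i < M) ∧
    p = (listVec (List.ofFn a) (n - N), levelProd r n a M • schurDet n a)}

/-- Both operators lower one entry at a time, and `levelProd_update` matches the weights. If the
lowered sequence repeats a value or drops below `n - N`, both components are zero, so `levelProd` is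
irrelevant there. -/
theorem wedgeRel_step (r : ℤ → ℂ) (n : ℤ) (N : ℕ) (M : ℤ) (m : ℕ+) (p : Fock × SymFun)
    (hp : p ∈ wedgeRel r n N M) :
    (opAdj r m p.1, MvPolynomial.pderiv m p.2) ∈ wedgeRel r n N M := by
  have hm : 0 < ((m : ℕ) : ℤ) := by exact_mod_cast m.pos
  suffices h : wedgeRel r n N M ≤ (wedgeRel r n N M).comap
      ((opAdj r m).prodMap (MvPolynomial.pderiv m).toLinearMap) from h hp
  conv_lhs => rw [wedgeRel]
  rw [Submodule.span_le]
  rintro _ ⟨a, haM, rfl⟩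
  change (opAdj r m (listVec (List.ofFn a) (n - N)),
    MvPolynomial.pderiv m (levelProd r n a M • schurDet n a)) ∈ wedgeRel r n N M
  rw [opAdj, shiftOp_listVec _ _ hm, Derivation.map_smul, pderiv_schurDet, Finset.smul_sum]
  have hsum : ∀ (f : Fin N → Fock) (g : Fin N → SymFun),
      (∑ i, f i, ∑ i, g i) = ∑ i, (f i, g i) := fun f g =>
    Prod.ext (by rw [Prod.fst_sum]) (by rw [Prod.snd_sum])
  rw [hsum]
  refine Submodule.sum_mem _ fun i _ => ?_
  set a' := Function.update a i (a i - ((m : ℕ) : ℤ)) with ha'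
  have hf : ∏ l ∈ Finset.range m, r (a i - ((m : ℕ) : ℤ) + (m : ℕ) - l) =
      ∏ l ∈ Finset.range m, r (a i - l) := by
    simp only [sub_add_cancel]
  rw [hf]
  by_cases hinj : Function.Injective a'
  · by_cases hc : ∀ l, n - N ≤ a' l
    · rw [levelProd_update r n a i m (haM i) hinj hc, mul_smul, ← ha', ← Prod.smul_mk]
      refine Submodule.smul_mem _ _ (Submodule.subset_span ⟨a', fun l => ?_, rfl⟩)
      by_cases hl : l = i
      · rw [hl, ha', Function.update_self]
        have := haM i
        omega
      · rw [ha', Function.update_of_ne hl]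
        exact haM l
    · push Not at hc
      obtain ⟨l, hl⟩ := hc
      rw [listVec_eq_zero (Or.inr ⟨a' l, List.mem_ofFn.mpr ⟨l, rfl⟩, hl⟩),
        schurDet_eq_zero_of_lt n a' l hl, smul_zero, smul_zero]
      exact zero_mem _
  · rw [listVec_eq_zero (Or.inl (by rwa [List.nodup_ofFn])),
      schurDet_eq_zero_of_not_injective n a' hinj, smul_zero, smul_zero]
    exact zero_mem _

theorem fockForm_vac_formalExp_opAdj (r : ℤ → ℂ) (n : ℤ) {N : ℕ} (a : Fin N → ℤ) {M : ℤ}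
    (hM : ∀ i, a i < M) (d : ℕ+ →₀ ℕ) :
    fockForm (vac n) (MvPowerSeries.coeff d (formalExp (linearSeries (opAdj r)))
      (listVec (List.ofFn a) (n - N))) =
      levelProd r n a M * MvPolynomial.coeff d (schurDet n a) := by
  have h := formalExp_apply_of_rel (opAdj r) (wedgeRel r n N M) (fockForm (vac n))
    (wedgeRel_step r n N M) (fun p hp => ?_) d
    (listVec (List.ofFn a) (n - N), levelProd r n a M • schurDet n a)
    (Submodule.subset_span ⟨a, hM, rfl⟩)
  · rw [h, MvPolynomial.coeff_smul, smul_eq_mul]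
  · suffices h : wedgeRel r n N M ≤ LinearMap.eqLocus (fockForm (vac n) ∘ₗ LinearMap.fst ℂ _ _)
        (MvPolynomial.lcoeff ℂ 0 ∘ₗ LinearMap.snd ℂ _ _) from h hp
    rw [wedgeRel, Submodule.span_le]
    rintro _ ⟨a, -, rfl⟩
    change fockForm (vac n) (listVec (List.ofFn a) (n - N)) =
      MvPolynomial.coeff 0 (levelProd r n a M • schurDet n a)
    rw [fockForm_vac_listVec, MvPolynomial.coeff_smul, smul_eq_mul, levelProd_mul_coeff_zero]

/-! ## The basis of Fock space indexed by partitions -/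

/-- The levels `n - 1 - i + λ_i`, `0 ≤ i < N`. -/
def levels (n : ℤ) (μ : YoungDiagram) (N : ℕ) : Fin N → ℤ :=
  fun i => n - 1 - (i : ℤ) + μ.rowLen i

theorem levels_strictAnti (n : ℤ) (μ : YoungDiagram) (N : ℕ) : StrictAnti (levels n μ N) := by
  intro i j hij
  have h1 := μ.rowLen_anti i j (by exact_mod_cast hij.le)
  have h2 : (i : ℕ) < j := hij
  simp only [levels]
  omega

theorem le_levels (n : ℤ) (μ : YoungDiagram) (N : ℕ) (i : Fin N) : n - N ≤ levels n μ N i := by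
  have := i.isLt
  simp only [levels]
  omega

theorem rowLen_eq_zero {μ : YoungDiagram} {i : ℕ} (h : μ.colLen 0 ≤ i) : μ.rowLen i = 0 := by
  by_contra h0
  have : (i, 0) ∈ μ := YoungDiagram.mem_iff_lt_rowLen.mpr (Nat.pos_of_ne_zero h0)
  exact absurd (YoungDiagram.mem_iff_lt_colLen.mp this) (by omega)

/-- The vector of charge `n` corresponding to a partition. -/
def schurVec (n : ℤ) (μ : YoungDiagram) : Fock :=
  listVec (List.ofFn (levels n μ (μ.colLen 0))) (n - μ.colLen 0)

/-- Empty rows occupy the vacuum levels, which the deeper vacuum absorbs. -/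
theorem listVec_levels (n : ℤ) (μ : YoungDiagram) {N : ℕ} (hN : μ.colLen 0 ≤ N) :
    listVec (List.ofFn (levels n μ N)) (n - N) = schurVec n μ := by
  induction N, hN using Nat.le_induction with
  | base => rfl
  | succ N hN ih =>
    rw [← ih, List.ofFn_succ', List.concat_eq_append]
    have h : levels n μ (N + 1) (Fin.last N) = n - (N + 1 : ℕ) := by
      simp only [levels, Fin.val_last, rowLen_eq_zero hN]
      push_cast
      ring
    rw [h, listVec_concat]
    congr 1
    push_cast
    ring

theorem rowLen_inj {μ ν : YoungDiagram} (h : ∀ i, μ.rowLen i = ν.rowLen i) : μ = ν := by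
  ext ⟨i, j⟩
  rw [YoungDiagram.mem_cells, YoungDiagram.mem_cells, YoungDiagram.mem_iff_lt_rowLen,
    YoungDiagram.mem_iff_lt_rowLen, h]

theorem fockForm_schurVec_self (n : ℤ) (μ : YoungDiagram) :
    fockForm (schurVec n μ) (schurVec n μ) = 1 := by
  rw [schurVec, fockForm_listVec _ _ (le_levels n μ _)]
  convert Matrix.det_one (R := ℂ) (n := Fin (μ.colLen 0)) using 2
  ext1 i j
  rw [Matrix.of_apply, Matrix.one_apply]
  exact if_congr (levels_strictAnti n μ _).injective.eq_iff rfl rfl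

/-- At a common length, a nonzero determinant would make the two level sequences permutations of
each other. Both being strictly decreasing, they would coincide. -/
theorem fockForm_schurVec_of_ne (n : ℤ) {μ ν : YoungDiagram} (hne : μ ≠ ν) :
    fockForm (schurVec n μ) (schurVec n ν) = 0 := by
  set N := max (μ.colLen 0) (ν.colLen 0) with hN
  have hμ : μ.colLen 0 ≤ N := le_max_left _ _
  have hν : ν.colLen 0 ≤ N := le_max_right _ _
  rw [← listVec_levels n μ hμ, ← listVec_levels n ν hν, fockForm_listVec _ _ (le_levels n μ N)]
  by_contra hdet
  rw [Matrix.det_apply] at hdet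
  obtain ⟨σ, -, hσ⟩ := Finset.exists_ne_zero_of_sum_ne_zero hdet
  have h1 : ∀ i, levels n ν N (σ i) = levels n μ N i := by
    intro i
    by_contra hi
    apply hσ
    rw [Finset.prod_eq_zero (Finset.mem_univ i), smul_zero]
    simp [hi]
  have h2 : σ = 1 := by
    refine perm_eq_one_of_antivary (levels n ν N) (levels_strictAnti n ν N) σ fun i j hij => ?_
    have hij : (i : ℤ) < j := hij
    simp only [Function.comp_apply, h1]
    exact (levels_strictAnti n μ N).antitone (by exact_mod_cast hij.le)
  refine hne (rowLen_inj fun i => ?_)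
  rcases lt_or_ge i N with h | h
  · have := h1 ⟨i, h⟩
    simp only [h2, Equiv.Perm.one_apply, levels] at this
    omega
  · rw [rowLen_eq_zero (hμ.trans h), rowLen_eq_zero (hν.trans h)]

theorem exists_levels_eq (n : ℤ) {N : ℕ} (a : Fin N → ℤ) (ha : StrictAnti a)
    (hc : ∀ i, n - N ≤ a i) : ∃ μ : YoungDiagram, μ.colLen 0 ≤ N ∧ levels n μ N = a := by
  rcases N with _ | N
  · refine ⟨⊥, ?_, Subsingleton.elim _ _⟩
    by_contra h
    exact YoungDiagram.notMem_bot (0, 0) (YoungDiagram.mem_iff_lt_colLen.mpr (by omega))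
  -- Candidate row lengths: strict decrease of `a` makes `b` weakly decreasing, and the lower bound
  -- on the last entry makes it nonnegative.
  let b : Fin (N + 1) → ℤ := fun i => a i - (n - 1 - (i : ℤ))
  have hb : Antitone b := by
    rw [Fin.antitone_iff_succ_le]
    intro i
    have := ha (Fin.castSucc_lt_succ (i := i))
    simp only [b, Fin.val_succ, Fin.val_castSucc]
    push_cast
    omega
  have hb0 : ∀ i, 0 ≤ b i := by
    intro i
    refine le_trans ?_ (hb (Fin.le_last i))
    have := hc (Fin.last N)
    simp only [b, Fin.val_last]
    push_cast at this
    omega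
  let w : Fin (N + 1) → ℕ := fun i => (b i).toNat
  have hw : Antitone w := fun i j hij => Int.toNat_le_toNat (hb hij)
  let μ := YoungDiagram.ofRowLens (List.ofFn w) hw.sortedGE_ofFn
  refine ⟨μ, ?_, ?_⟩
  · by_contra h
    have h1 : (N + 1, 0) ∈ μ := YoungDiagram.mem_iff_lt_colLen.mpr (by omega)
    obtain ⟨h2, -⟩ := YoungDiagram.mem_ofRowLens.mp h1
    simp at h2
  · ext i
    have h1 : μ.rowLen i = w i := by
      have := YoungDiagram.rowLen_ofRowLens (w := List.ofFn w) (hw := hw.sortedGE_ofFn)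
        (Fin.cast (List.length_ofFn).symm i)
      exact this.trans (by simp [-List.ofFn_succ])
    have h2 : (w i : ℤ) = b i := Int.toNat_of_nonneg (hb0 i)
    simp only [levels]
    rw [h1, h2]
    simp only [b]
    ring

/-- A nonzero wedge vector has distinct levels above the sea; sorted decreasingly, they are the
levels of a partition. -/
theorem chargeSpan_le (n : ℤ) : chargeSpan n ≤ Submodule.span ℂ (Set.range (schurVec n)) := by
  rw [chargeSpan, Submodule.span_le]
  rintro _ ⟨L, c, hL, rfl⟩
  rw [SetLike.mem_coe]
  by_cases h0 : ¬ L.Nodup ∨ ∃ m ∈ L, m < c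
  · rw [listVec_eq_zero h0]
    exact zero_mem _
  · rw [not_or, not_not] at h0
    obtain ⟨hnodup, hlt⟩ := h0
    push Not at hlt
    set L' := L.insertionSort (· ≥ ·) with hL'
    have hperm : L'.Perm L := List.perm_insertionSort _ L
    have hsort : L'.SortedGT :=
      List.SortedGE.sortedGT_of_nodup List.sortedGE_insertionSort (hperm.nodup_iff.mpr hnodup)
    have hofFn : L' = List.ofFn L'.get := (List.ofFn_get L').symm
    have hc : n - L'.length = c := by
      rw [hperm.length_eq]
      omega
    obtain ⟨μ, hμ, hlev⟩ := exists_levels_eq n L'.get (by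
      rw [hofFn, List.sortedGT_ofFn_iff] at hsort
      exact hsort) (by
      intro i
      rw [hc]
      exact hlt _ (hperm.mem_iff.mp (List.get_mem _ _)))
    have h1 : listVec L' c = schurVec n μ := by
      rw [← listVec_levels n μ hμ, hlev, ← hofFn, hc]
    refine Submodule.span_mono ?_ (listVec_perm hperm.symm c)
    rw [h1, Set.singleton_subset_iff]
    exact Set.mem_range_self μ

/-! ### Comparison with content products -/

/-- The nodes of row `i` have shifted contents `n - i, …, n - i + λ_i - 1`, the levels crossed by
the `i`-th fermion. -/
theorem contentProd_eq (r : ℤ → ℂ) (n : ℤ) (μ : YoungDiagram) : contentProd r μ n =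
    ∏ i : Fin (μ.colLen 0), ∏ j ∈ Finset.Ioc (n - 1 - (i : ℤ)) (levels n μ (μ.colLen 0) i), r j := by
  have h1 : contentProd r μ n = ∏ i ∈ Finset.range (μ.colLen 0),
      ∏ j ∈ Finset.range (μ.rowLen i), r (n + j - i) := by
    rw [contentProd, Finset.prod_sigma']
    refine Finset.prod_nbij' (fun c => ⟨c.1, c.2⟩) (fun c => (c.1, c.2)) ?_ ?_ ?_ ?_ ?_
    · rintro ⟨i, j⟩ h
      rw [YoungDiagram.mem_cells] at h
      rw [Finset.mem_sigma, Finset.mem_range, Finset.mem_range]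
      exact ⟨YoungDiagram.mem_iff_lt_colLen.mp (μ.up_left_mem le_rfl (Nat.zero_le _) h),
        YoungDiagram.mem_iff_lt_rowLen.mp h⟩
    · rintro ⟨i, j⟩ h
      rw [Finset.mem_sigma, Finset.mem_range, Finset.mem_range] at h
      exact YoungDiagram.mem_iff_lt_rowLen.mpr h.2
    · intro c _; rfl
    · intro c _; rfl
    · intro c _; rfl
  rw [h1, Finset.prod_range]
  refine Finset.prod_congr rfl fun i _ => ?_
  refine Finset.prod_nbij' (fun j => n + j - i) (fun j => (j - (n - i)).toNat) ?_ ?_ ?_ ?_ ?_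
  · intro j hj; rw [Finset.mem_range] at hj; rw [Finset.mem_Ioc, levels]; omega
  · intro j hj; rw [Finset.mem_Ioc, levels] at hj; rw [Finset.mem_range]; omega
  · intro j _; omega
  · intro j hj; rw [Finset.mem_Ioc] at hj; omega
  · intro j _; rfl

/-- Exchange of products: the excess at level `j` counts the rows whose interval of crossed levels
contains `j`. -/
theorem levelProd_levels (r : ℤ → ℂ) (n : ℤ) (μ : YoungDiagram) {M : ℤ}
    (hM : ∀ i, levels n μ (μ.colLen 0) i < M) :
    levelProd r n (levels n μ (μ.colLen 0)) M = contentProd r μ n := by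
  rw [contentProd_eq, levelProd]
  have h1 : ∀ i : Fin (μ.colLen 0),
      ∏ j ∈ Finset.Ioc (n - 1 - (i : ℤ)) (levels n μ (μ.colLen 0) i), r j =
        ∏ j ∈ Finset.Ico (n - μ.colLen 0) M,
          r j ^ (if n - 1 - (i : ℤ) < j ∧ j ≤ levels n μ (μ.colLen 0) i then 1 else 0) := by
    intro i
    have := i.isLt
    exact (prod_ite_interval r (by omega) (hM i)).symm
  simp only [h1]
  rw [Finset.prod_comm]
  refine Finset.prod_congr rfl fun j _ => ?_
  rw [Finset.prod_pow_eq_pow_sum]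
  congr 1
  rw [excess, Finset.card_filter, Finset.card_filter, Nat.sub_eq_iff_eq_add,
    ← Finset.sum_add_distrib]
  · refine Finset.sum_congr rfl fun i _ => ?_
    have hi : n - 1 - (i : ℤ) ≤ levels n μ (μ.colLen 0) i := by simp [levels]
    by_cases h2 : j ≤ n - 1 - (i : ℤ)
    · simp [h2, h2.trans hi]
    · simp [h2, not_le.mp h2]
  · refine Finset.sum_le_sum fun i _ => ?_
    have hi : n - 1 - (i : ℤ) ≤ levels n μ (μ.colLen 0) i := by simp [levels]
    by_cases h2 : j ≤ n - 1 - (i : ℤ)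
    · simp [h2, h2.trans hi]
    · simp [h2]

theorem fockForm_vac_opAdj_schurVec (r : ℤ → ℂ) (n : ℤ) (μ : YoungDiagram) (d : ℕ+ →₀ ℕ) :
    fockForm (vac n) (MvPowerSeries.coeff d (formalExp (linearSeries (opAdj r)))
      (schurVec n μ)) = contentProd r μ n * MvPolynomial.coeff d (schur μ) := by
  have hM : ∀ i, levels n μ (μ.colLen 0) i < n + μ.rowLen 0 := by
    intro i
    have := μ.rowLen_anti 0 i (Nat.zero_le _)
    simp only [levels]
    omega
  rw [schurVec, fockForm_vac_formalExp_opAdj r n _ hM, levelProd_levels r n μ hM,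
    schur_eq_schurDet n]
  rfl

/-! ## The expansion of the tau function -/

theorem expNegA_eq (r : ℤ → ℂ) :
    expNegA r = formalExp (linearSeries fun m => -opA r m) :=
  formalExp_neg_linearSeries _

theorem neg_opA_mem_chargeSpan (r : ℤ → ℂ) (m : ℕ+) {q : ℤ} {x : Fock} (hx : x ∈ chargeSpan q) :
    (-opA r m) x ∈ chargeSpan q := by
  rw [neg_opA_eq r m (neg_ne_zero.mpr (Int.natCast_ne_zero.mpr m.pos.ne')) rfl]
  exact shiftOp_mem_chargeSpan _ _ hx

/-- The vector `e^{-A(t*)} |n⟩` expanded in the vectors of the partitions. -/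
theorem exists_expNegA_vac (r : ℤ → ℂ) (n : ℤ) (e : ℕ+ →₀ ℕ) : ∃ g : YoungDiagram →₀ ℂ,
    (∀ μ, g μ = contentProd r μ n * MvPolynomial.coeff e (schur μ)) ∧
      MvPowerSeries.coeff e (expNegA r) (vac n) = ∑ μ ∈ g.support, g μ • schurVec n μ := by
  have h1 : MvPowerSeries.coeff e (expNegA r) (vac n) ∈ chargeSpan n := by
    rw [expNegA_eq]
    exact formalExp_mem _ _ (fun m x hx => neg_opA_mem_chargeSpan r m hx) (vac_mem_chargeSpan n) e
  obtain ⟨g, hg⟩ := Finsupp.mem_span_range_iff_exists_finsupp.mp (chargeSpan_le n h1)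
  refine ⟨g, fun μ => ?_, hg.symm⟩
  -- Orthonormality reads off the coordinate; the exponential then passes to its adjoint on the
  -- other side.
  have h2 : fockForm (MvPowerSeries.coeff e (expNegA r) (vac n)) (schurVec n μ) = g μ := by
    rw [← hg, Finsupp.sum, map_sum, LinearMap.sum_apply, Finset.sum_eq_single μ]
    · rw [map_smul, LinearMap.smul_apply, fockForm_schurVec_self, smul_eq_mul, mul_one]
    · intro ν _ hν
      rw [map_smul, LinearMap.smul_apply, fockForm_schurVec_of_ne n hν, smul_zero]
    · intro hμ
      rw [Finsupp.notMem_support_iff.mp hμ, zero_smul, map_zero, LinearMap.zero_apply]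
  rw [← h2, expNegA_eq, formalExp_adjoint fockForm _ _ (fockForm_opA r),
    fockForm_vac_opAdj_schurVec]

theorem contentProd_one (μ : YoungDiagram) (n : ℤ) : contentProd (fun _ => 1) μ n = 1 :=
  Finset.prod_const_one

theorem fockForm_vac_expH_schurVec (n : ℤ) (μ : YoungDiagram) (d : ℕ+ →₀ ℕ) :
    fockForm (vac n) (MvPowerSeries.coeff d expH (schurVec n μ)) =
      MvPolynomial.coeff d (schur μ) := by
  rw [expH, ← funext opAdj_one, fockForm_vac_opAdj_schurVec, contentProd_one, one_mul]

/-- For `r = 1` these numbers are the coordinates of a single vector of Fock space, so no degree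
count is needed. -/
theorem finite_support_coeff_schur (e : ℕ+ →₀ ℕ) :
    (Function.support fun μ => MvPolynomial.coeff e (schur μ)).Finite := by
  obtain ⟨g, hg, -⟩ := exists_expNegA_vac (fun _ => 1) 0 e
  refine g.support.finite_toSet.subset fun μ hμ => ?_
  rw [Finset.mem_coe, Finsupp.mem_support_iff, hg, contentProd_one, one_mul]
  exact hμ

/-- The partitions whose Schur function contains a given monomial. -/
def schurSupport (e : ℕ+ →₀ ℕ) : Finset YoungDiagram := (finite_support_coeff_schur e).toFinset

theorem mem_schurSupport {e : ℕ+ →₀ ℕ} {μ : YoungDiagram} :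
    μ ∈ schurSupport e ↔ MvPolynomial.coeff e (schur μ) ≠ 0 := by
  rw [schurSupport, Set.Finite.mem_toFinset, Function.mem_support]

theorem fockForm_vac_expH_expNegA (r : ℤ → ℂ) (n : ℤ) (d e : ℕ+ →₀ ℕ) :
    fockForm (vac n) (MvPowerSeries.coeff d expH (MvPowerSeries.coeff e (expNegA r) (vac n))) =
      ∑ μ ∈ schurSupport e, contentProd r μ n *
        (MvPolynomial.coeff d (schur μ) * MvPolynomial.coeff e (schur μ)) := by
  obtain ⟨g, hg, hsum⟩ := exists_expNegA_vac r n e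
  have h : g.support ⊆ schurSupport e := by
    intro μ hμ
    rw [Finsupp.mem_support_iff, hg] at hμ
    exact mem_schurSupport.mpr (right_ne_zero_of_mul hμ)
  rw [hsum, Finset.sum_subset h fun μ _ hμ => by
    rw [Finsupp.notMem_support_iff.mp hμ, zero_smul], map_sum, map_sum]
  refine Finset.sum_congr rfl fun μ _ => ?_
  rw [map_smul, map_smul, fockForm_vac_expH_schurVec, hg, smul_eq_mul]
  ring

theorem coeff_tau (r : ℤ → ℂ) (n : ℤ) (d : ℕ+ ⊕ ℕ+ →₀ ℕ) : MvPowerSeries.coeff d (tau r n) =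
    ∑ μ ∈ schurSupport (Finsupp.sumFinsuppEquivProdFinsupp d).2, contentProd r μ n *
      (MvPolynomial.coeff (Finsupp.sumFinsuppEquivProdFinsupp d).1 (schur μ) *
        MvPolynomial.coeff (Finsupp.sumFinsuppEquivProdFinsupp d).2 (schur μ)) := by
  rw [← fockForm_vac_expH_expNegA]
  exact expectation_eq n _

/-! ## The Cauchy identity -/

/-- The operator `B_m` adjoint to `H_m`. -/
def opB (m : ℕ+) : Module.End ℂ Fock := -opA (fun _ => 1) m

theorem opB_eq (m : ℕ+) : opB m = shiftOp (fun _ => 1)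
    (k := -((m : ℕ) : ℤ)) (neg_ne_zero.mpr (Int.natCast_ne_zero.mpr m.pos.ne')) := by
  rw [opB, neg_opA_eq _ m (neg_ne_zero.mpr (Int.natCast_ne_zero.mpr m.pos.ne')) rfl]
  simp only [Finset.prod_const_one]

theorem opH_opB (m l : ℕ+) {q : ℤ} {x : Fock} (hx : x ∈ chargeSpan q) :
    opH m (opB l x) = opB l (opH m x) + (if l = m then ((m : ℕ) : ℂ) else 0) • x := by
  rw [opB_eq, opH_eq m (Int.natCast_ne_zero.mpr m.pos.ne') rfl,
    shiftOp_commute _ _ (by exact_mod_cast m.pos) (by exact_mod_cast l.pos) hx]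
  congr 2
  simp [eq_comm]

theorem fockForm_opH (m : ℕ+) (x y : Fock) :
    fockForm (opH m x) y = fockForm x (opB m y) := by
  rw [opB_eq, opH_eq m (Int.natCast_ne_zero.mpr m.pos.ne') rfl,
    fockForm_shiftOp (fun _ => 1) (fun _ => 1) _ _ rfl fun _ => rfl]

theorem opH_vac (m : ℕ+) (n : ℤ) : opH m (vac n) = 0 := by
  rw [opH_eq m (Int.natCast_ne_zero.mpr m.pos.ne') rfl]
  exact shiftOp_vac _ _ (by exact_mod_cast m.pos) n

/-- The vector `B_{k_1} ⋯ B_{k_l} |n⟩`. -/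
def bosonVec (n : ℤ) (w : List ℕ+) : Fock := (w.map opB).prod (vac n)

/-- The product of the power sums `k_i γ_{k_i}`. -/
def bosonFun (w : List ℕ+) : SymFun :=
  (w.map fun m : ℕ+ => ((m : ℕ) : ℂ) • (MvPolynomial.X m : SymFun)).prod

theorem bosonVec_cons (n : ℤ) (m : ℕ+) (w : List ℕ+) :
    bosonVec n (m :: w) = opB m (bosonVec n w) := by
  rw [bosonVec, List.map_cons, List.prod_cons, Module.End.mul_apply, bosonVec]

theorem bosonFun_cons (m : ℕ+) (w : List ℕ+) :
    bosonFun (m :: w) = ((m : ℕ) : ℂ) • (MvPolynomial.X m : SymFun) * bosonFun w := by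
  rw [bosonFun, List.map_cons, List.prod_cons, bosonFun]

theorem bosonVec_mem_chargeSpan (n : ℤ) (w : List ℕ+) : bosonVec n w ∈ chargeSpan n := by
  induction w with
  | nil => exact vac_mem_chargeSpan n
  | cons m w ih =>
    rw [bosonVec_cons]
    exact neg_opA_mem_chargeSpan _ m ih

/-- The boson-fermion correspondence, as the relation spanned by the pairs of
`B_{k_1} ⋯ B_{k_l} |n⟩` and the product of the power sums `k_i γ_{k_i}`. -/
def bosonRel (n : ℤ) : Submodule ℂ (Fock × SymFun) :=
  Submodule.span ℂ (Set.range fun w => (bosonVec n w, bosonFun w))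

theorem bosonRel_opB (n : ℤ) (m : ℕ+) (p : Fock × SymFun) (hp : p ∈ bosonRel n) :
    (opB m p.1, ((m : ℕ) : ℂ) • (MvPolynomial.X m : SymFun) * p.2) ∈ bosonRel n := by
  suffices h : bosonRel n ≤ (bosonRel n).comap ((opB m).prodMap
      (LinearMap.mulLeft ℂ (((m : ℕ) : ℂ) • (MvPolynomial.X m : SymFun)))) from h hp
  conv_lhs => rw [bosonRel]
  rw [Submodule.span_le]
  rintro _ ⟨w, rfl⟩
  refine Submodule.subset_span ⟨m :: w, ?_⟩
  simp only [bosonVec_cons, bosonFun_cons]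
  rfl

/-- Induction on the word: the Heisenberg relation on one side matches the Leibniz rule for `l γ_l`
on the other, starting from `H_m |n⟩ = 0` and `∂1 = 0`. -/
theorem bosonRel_opH (n : ℤ) (m : ℕ+) (p : Fock × SymFun) (hp : p ∈ bosonRel n) :
    (opH m p.1, MvPolynomial.pderiv m p.2) ∈ bosonRel n := by
  suffices h : bosonRel n ≤ (bosonRel n).comap
      ((opH m).prodMap (MvPolynomial.pderiv m).toLinearMap) from h hp
  conv_lhs => rw [bosonRel]
  rw [Submodule.span_le]
  rintro _ ⟨w, rfl⟩
  change (opH m (bosonVec n w), MvPolynomial.pderiv m (bosonFun w)) ∈ bosonRel n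
  induction w with
  | nil =>
    have h : (opH m (bosonVec n []), MvPolynomial.pderiv m (bosonFun [])) = 0 := by
      refine Prod.ext (opH_vac m n) ?_
      simp [bosonFun]
    rw [h]
    exact zero_mem _
  | cons l w ih =>
    have h : (opH m (bosonVec n (l :: w)), MvPolynomial.pderiv m (bosonFun (l :: w))) =
        (opB l (opH m (bosonVec n w)),
          ((l : ℕ) : ℂ) • (MvPolynomial.X l : SymFun) * MvPolynomial.pderiv m (bosonFun w)) +
        (if l = m then ((m : ℕ) : ℂ) else 0) • (bosonVec n w, bosonFun w) := by
      rw [bosonVec_cons, bosonFun_cons, opH_opB m l (bosonVec_mem_chargeSpan n w)]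
      refine Prod.ext rfl ?_
      simp only [Derivation.leibniz, Derivation.map_smul, Prod.snd_add, Prod.smul_snd, smul_eq_mul]
      congr 1
      by_cases hlm : l = m
      · subst hlm
        rw [MvPolynomial.pderiv_X_self, if_pos rfl, mul_smul_comm, mul_one]
      · rw [MvPolynomial.pderiv_X_of_ne hlm, if_neg hlm, smul_zero, mul_zero, zero_smul]
    rw [h]
    exact add_mem (bosonRel_opB n l _ ih)
      (Submodule.smul_mem _ _ (Submodule.subset_span ⟨w, rfl⟩))

/-- On a nonempty word, the adjoint `H_m` of the first `B_m` kills `|n⟩`, and the product of power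
sums has no constant term. -/
theorem bosonRel_eval (n : ℤ) (p : Fock × SymFun) (hp : p ∈ bosonRel n) :
    fockForm (vac n) p.1 = MvPolynomial.coeff 0 p.2 := by
  suffices h : bosonRel n ≤ LinearMap.eqLocus (fockForm (vac n) ∘ₗ LinearMap.fst ℂ _ _)
      (MvPolynomial.lcoeff ℂ 0 ∘ₗ LinearMap.snd ℂ _ _) from h hp
  rw [bosonRel, Submodule.span_le]
  rintro _ ⟨w, rfl⟩
  change fockForm (vac n) (bosonVec n w) = MvPolynomial.coeff 0 (bosonFun w)
  rcases w with _ | ⟨m, w⟩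
  · have h : MvPolynomial.coeff 0 (bosonFun []) = 1 := by simp [bosonFun]
    rw [h]
    exact fockForm_vac_self n
  · rw [bosonVec_cons, ← fockForm_opH, opH_vac, map_zero, LinearMap.zero_apply, bosonFun_cons,
      ← MvPolynomial.constantCoeff_eq, map_mul, MvPolynomial.smul_eq_C_mul]
    simp

/-- Both exponentials satisfy the same recursion in the degree, with `B_m` on one side and
multiplication by `m γ_m` on the other. -/
theorem formalExp_mem_bosonRel (n : ℤ) (e : ℕ+ →₀ ℕ) :
    (MvPowerSeries.coeff e (formalExp (linearSeries opB)) (vac n),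
      MvPowerSeries.coeff e expGamma) ∈ bosonRel n := by
  induction e using exponent_induction with
  | zero =>
    rw [expGamma, coeff_zero_formalExp, coeff_zero_formalExp]
    exact Submodule.subset_span ⟨[], by simp [bosonVec, bosonFun]⟩
  | step e he ih =>
    rw [← (bosonRel n).smul_mem_iff he, Prod.smul_mk, ← LinearMap.smul_apply, expGamma,
      degree_smul_coeff_formalExp_left, degree_smul_coeff_formalExp_left, LinearMap.sum_apply]
    have hsum : ∀ (f : ℕ+ → Fock) (g : ℕ+ → SymFun),
        (∑ i ∈ e.support, f i, ∑ i ∈ e.support, g i) = ∑ i ∈ e.support, (f i, g i) := fun f g =>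
      Prod.ext (by rw [Prod.fst_sum]) (by rw [Prod.snd_sum])
    rw [hsum]
    exact Submodule.sum_mem _ fun i hi => bosonRel_opB n i _ (ih i hi)

/-- The Cauchy identity `exp (∑ m t_m γ_m) = ∑ s_λ(t) s_λ(γ)`. -/
theorem coeff_expGamma (e : ℕ+ →₀ ℕ) : MvPowerSeries.coeff e expGamma =
    ∑ μ ∈ schurSupport e, MvPolynomial.coeff e (schur μ) • schur μ := by
  ext d
  -- `⟨0| e^{H(t)} e^{B(t*)} |0⟩` is computed twice: in `h1` through bosons, in `h2` through wedge
  -- vectors. The charge `0` is an arbitrary choice.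
  have h1 := formalExp_apply_of_rel opH (bosonRel 0) (fockForm (vac 0)) (bosonRel_opH 0)
    (bosonRel_eval 0) d _ (formalExp_mem_bosonRel 0 e)
  have h2 := fockForm_vac_expH_expNegA (fun _ => 1) 0 d e
  rw [expNegA_eq] at h2
  rw [← h1, MvPolynomial.coeff_sum]
  refine h2.trans (Finset.sum_congr rfl fun μ _ => ?_)
  rw [contentProd_one, one_mul, MvPolynomial.coeff_smul, smul_eq_mul, mul_comm]

theorem deformedForm_expGamma (r : ℤ → ℂ) (n : ℤ) (d e : ℕ+ →₀ ℕ) :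
    deformedForm r n (MvPowerSeries.coeff d expGamma) (MvPowerSeries.coeff e expGamma) =
      ∑ μ ∈ schurSupport e, contentProd r μ n *
        (MvPolynomial.coeff d (schur μ) * MvPolynomial.coeff e (schur μ)) := by
  classical
  rw [coeff_expGamma d, coeff_expGamma e, map_sum]
  refine Finset.sum_congr rfl fun μ _ => ?_
  rw [map_smul, map_sum, LinearMap.sum_apply, Finset.sum_eq_single μ]
  · rw [map_smul, LinearMap.smul_apply, deformedForm_schur, if_pos rfl, smul_eq_mul, smul_eq_mul]
    ring
  · intro ν _ hν
    rw [map_smul, LinearMap.smul_apply, deformedForm_schur, if_neg hν, smul_zero]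
  -- A partition outside the support for `d` contributes zero, so the sum may stay over the support
  -- for `e`.
  · intro hμ
    rw [mem_schurSupport, not_not] at hμ
    rw [hμ, zero_smul, map_zero, LinearMap.zero_apply]

end

end HypTau

/-! ### The two formulas for the tau function -/

theorem mainTheorem2 (r : ℤ → ℂ) (n : ℤ) :
    HypTau.tau r n =
        HypTau.pairSeries (fun f g => HypTau.deformedForm r n f g)
          HypTau.expGamma HypTau.expGamma ∧
      HypTau.FormalHasSum
        (fun μ : YoungDiagram => HypTau.contentProd r μ n • HypTau.schurSchur μ)
        (HypTau.tau r n) := by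
  constructor
  · ext d
    rw [HypTau.coeff_tau]
    exact (HypTau.deformedForm_expGamma r n _ _).symm
  · intro d
    have h : ∀ μ, MvPowerSeries.coeff d (HypTau.contentProd r μ n • HypTau.schurSchur μ) =
        HypTau.contentProd r μ n *
          (MvPolynomial.coeff (Finsupp.sumFinsuppEquivProdFinsupp d).1 (HypTau.schur μ) *
            MvPolynomial.coeff (Finsupp.sumFinsuppEquivProdFinsupp d).2 (HypTau.schur μ)) :=
      fun _ => rfl
    -- The exponent of `t*` alone already restricts to finitely many partitions.
    have hs : (Function.support fun μ =>
        MvPowerSeries.coeff d (HypTau.contentProd r μ n • HypTau.schurSchur μ)) ⊆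
        HypTau.schurSupport (Finsupp.sumFinsuppEquivProdFinsupp d).2 := by
      intro μ hμ
      rw [Function.mem_support, h] at hμ
      exact HypTau.mem_schurSupport.mpr (right_ne_zero_of_mul (right_ne_zero_of_mul hμ))
    refine ⟨(Finset.finite_toSet _).subset hs, ?_⟩
    rw [finsum_eq_sum_of_support_subset _ hs, HypTau.coeff_tau]
    exact Finset.sum_congr rfl fun μ _ => (h μ).symm
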